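/- Let $f\colon \mathbb A^3_{\mathbb Q}\to\mathbb A^3_{\mathbb Q}$, $f(x,y,z)=(y,\;x+y-y^3,\;2z-y)$. For $n\ge 1$ let $\mathrm{Per}_n(f)=\{P\in\mathbb A^3(\overline{\mathbb Q}) : f^n(P)=P\}$ and $\mathrm{Per}(f)=\bigcup_{n\ge1}\mathrm{Per}_n(f)$. A point $P\in\mathrm{Per}(f)$ is called isolated if, for every $n\ge 1$, it does not lie in the Zariski closure of $\mathrm{Per}_n(f)\setminus\{P\}$; the same definitions are used for self-morphisms of $\mathbb A^N_{\overline{\mathbb Q}}$. Let $h$ be the restriction to $\mathbb A^N(\overline{\mathbb Q})\subset\mathbb P^N(\overline{\mathbb Q})$, $(x_1,\dots,x_N)\mapsto(1:x_1:\dots:x_N)$, of the absolute logarithmic Weil height. For $0\le p\le 3$ let $d_p(f)=\lim_{n\to\infty}\deg_p(f^n)^{1/n}$ be the $p$-th dynamical degree, where $\deg_p(g)$ is the degree of the preimage under $g$ of a general linear subspace of codimension $p$, i.e. the number of points of a general linear subspace of codimension $3-p$ that $g$ maps into a general linear subspace of codimension $p$. Then the following hold. 1. The morphism $f$ is an automorphism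 of $\mathbb A^3_{\mathbb Q}$, and $d_1(f)=d_2(f)=3$. 2. For every $n\ge1$ the set $\mathrm{Per}_n(f)$ is finite; thus all periodic points of $f$ are isolated. 3. There is a sequence $(P_i)_{i\ge1}$ of points of $\mathrm{Per}(f)$ such that $\lim_{i\to\infty}h(P_i)=\infty$ and $\{P_i : i\ge1\}$ is Zariski dense in $\mathbb A^3_{\overline{\mathbb Q}}$. Consequently, $f$ has degree at least two and its set of isolated periodic points has unbounded height, so the following conjecture of Silverman is false: for every automorphism of $\mathbb A^N_{\overline{\mathbb Q}}$ whose coordinate polynomials have maximal degree at least two, the set of isolated periodic points has bounded height. -/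

import Mathlib

open Filter Topology

/-- The field of algebraic numbers. -/
abbrev Qbar : Type := AlgebraicClosure ℚ

instance isAlgebraic_Qbar : Algebra.IsAlgebraic ℚ Qbar := AlgebraicClosure.isAlgebraic ℚ

namespace AffineDyn

variable {N : ℕ} {k : Type} [Field k]

/-! ### Polynomial self-maps of affine space -/

/-- A morphism `𝔸ᴺ → 𝔸ᴺ` over `k`, given by its coordinate polynomials, is an automorphism:
its comorphism `k[x] → k[x]`, `xᵢ ↦ Fᵢ`, is an isomorphism. -/
def IsAutomorphism (F : Fin N → MvPolynomial (Fin N) k) : Prop :=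
  Function.Bijective (MvPolynomial.aeval (R := k) F : MvPolynomial (Fin N) k →ₐ[k] _)

/-- The maximum of the total degrees of the coordinate polynomials. -/
def degree (F : Fin N → MvPolynomial (Fin N) k) : ℕ :=
  Finset.univ.sup fun i => (F i).totalDegree

/-- The action of a polynomial self-map of `𝔸ᴺ` over `k` on the points `𝔸ᴺ(ℚ̄)`. -/
noncomputable def onPoints [Algebra k Qbar] (F : Fin N → MvPolynomial (Fin N) k) :
    (Fin N → Qbar) → (Fin N → Qbar) :=
  fun P i => MvPolynomial.aeval P (F i)

/-! ### Zariski topology and periodic points -/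

/-- The set of `ℚ̄`-points of the Zariski closure in `𝔸ᴺ` over `ℚ̄` of a set of `ℚ̄`-points. -/
def zariskiClosure (S : Set (Fin N → Qbar)) : Set (Fin N → Qbar) :=
  MvPolynomial.zeroLocus Qbar (MvPolynomial.vanishingIdeal Qbar S)

/-- `Per_n(f, 𝔸ᴺ(ℚ̄))`, for a self-map `φ` of `𝔸ᴺ(ℚ̄)` and `n ≥ 1`. -/
def Per (n : ℕ) (φ : (Fin N → Qbar) → (Fin N → Qbar)) : Set (Fin N → Qbar) :=
  {P | φ^[n] P = P}

/-- `Per(f, 𝔸ᴺ(ℚ̄))`, the set of all periodic points. -/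
def PerAll (φ : (Fin N → Qbar) → (Fin N → Qbar)) : Set (Fin N → Qbar) :=
  {P | ∃ n : ℕ, 1 ≤ n ∧ P ∈ Per n φ}

/-- The isolated periodic points: for every `n ≥ 1`, the point is not in the Zariski closure of the
set of the other `n`-periodic points. -/
def IsolatedPer (φ : (Fin N → Qbar) → (Fin N → Qbar)) : Set (Fin N → Qbar) :=
  {P | P ∈ PerAll φ ∧ ∀ n : ℕ, 1 ≤ n → P ∉ zariskiClosure (Per n φ \ {P})}

/-! ### Dynamical degrees -/

/-- The value at `x` of the `i`-th of `N` affine forms with coefficients `a`. -/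
noncomputable def affineForm (a : Fin N × Option (Fin N) → Qbar) (i : Fin N) (x : Fin N → Qbar) :
    Qbar :=
  a (i, none) + ∑ j, a (i, some j) * x j

/-- `d` is the `p`-th degree (`0 ≤ p ≤ N`) of the polynomial self-map `φ` of `𝔸ᴺ(ℚ̄)`, viewed as a
rational self-map of `ℙᴺ`, that is, the intersection number `(φ^* Hᵖ · Hᴺ⁻ᵖ)`, which is the degree
of the preimage of a general linear subspace of codimension `p`: for a general linear subspace `L`
of codimension `p` and a general linear subspace `M` of codimension `N - p`, exactly `d` points
of `M` are mapped into `L`. Here `L` is cut out by the forms of index `i < p` and `M` by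
the other ones, and "general" means outside of a hypersurface `Φ = 0` in the space of all
coefficients. -/
def HasDegree (φ : (Fin N → Qbar) → (Fin N → Qbar)) (p d : ℕ) : Prop :=
  ∃ Φ : MvPolynomial (Fin N × Option (Fin N)) Qbar, Φ ≠ 0 ∧
    ∀ a : Fin N × Option (Fin N) → Qbar, MvPolynomial.eval a Φ ≠ 0 →
      {x : Fin N → Qbar |
        (∀ i : Fin N, i.val < p → affineForm a i (φ x) = 0) ∧
        (∀ i : Fin N, p ≤ i.val → affineForm a i x = 0)}.encard = d

/-- `δ` is the `p`-th dynamical degree of `φ`: the limit of `deg_p(φⁿ)^(1/n)` as `n → ∞`. -/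
def HasDynamicalDegree (φ : (Fin N → Qbar) → (Fin N → Qbar)) (p : ℕ) (δ : ℝ) : Prop :=
  ∃ d : ℕ → ℕ, (∀ n, HasDegree φ^[n] p (d n)) ∧
    Tendsto (fun n : ℕ => (d n : ℝ) ^ (1 / (n : ℝ))) atTop (𝓝 δ)

/-! ### Heights -/

/-- The field generated by the coordinates of a point. -/
noncomputable abbrev fieldOfDef (P : Fin N → Qbar) : IntermediateField ℚ Qbar :=
  IntermediateField.adjoin ℚ (Set.range P)

instance numberField_fieldOfDef (P : Fin N → Qbar) : NumberField (fieldOfDef P) where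
  to_charZero := inferInstance
  to_finiteDimensional :=
    IntermediateField.finiteDimensional_adjoin fun x _ => Algebra.IsIntegral.isIntegral x

/-- The coordinates of a point, as elements of the field that they generate. -/
noncomputable def coords (P : Fin N → Qbar) : Fin N → fieldOfDef P :=
  fun i => ⟨P i, IntermediateField.subset_adjoin ℚ _ ⟨i, rfl⟩⟩

/-- The restriction to `𝔸ᴺ(ℚ̄)` of the naive (absolute logarithmic Weil) height on `ℙᴺ(ℚ̄)`:
the height of `(1 : x₁ : ... : x_N)`. Mathlib's `Height.logHeight` is relative to the field `K`,
so it is divided by `[K : ℚ]`. -/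
noncomputable def height (P : Fin N → Qbar) : ℝ :=
  Height.logHeight (Matrix.vecCons (1 : fieldOfDef P) (coords P)) /
    (Module.finrank ℚ (fieldOfDef P) : ℝ)

/-- A set of points of `𝔸ᴺ(ℚ̄)` has bounded height. -/
def HeightBounded (S : Set (Fin N → Qbar)) : Prop :=
  ∃ C : ℝ, ∀ P ∈ S, |height P| ≤ C

/-- Silverman's conjecture: the isolated periodic points of an automorphism of degree at least two
of an affine space over `ℚ̄` form a set of bounded height. -/
def SilvermanConjecture : Prop :=
  ∀ (N : ℕ) (F : Fin N → MvPolynomial (Fin N) Qbar), IsAutomorphism F → 2 ≤ degree F →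
    HeightBounded (IsolatedPer (onPoints F))

/-! ### The map `(x, y, z) ↦ (y, x + y - y³, 2z - y)` -/

open MvPolynomial in
/-- The coordinate polynomials over `ℚ` of `(x, y, z) ↦ (y, x + y - y³, 2z - y)`. -/
noncomputable def f : Fin 3 → MvPolynomial (Fin 3) ℚ :=
  ![X 1, X 0 + X 1 - X 1 ^ 3, 2 * X 2 - X 1]

end AffineDyn

/-!
The map `f` fibres over the plane Hénon map `g (x, y) = (y, x + y - y³)`. Modulo `3` the cube is
the Frobenius `τ`, so `g` reduces to an additive map `M` with `M² = 1 + (1 - τ) M`; hence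
`M ^ (2 * 3 ^ m) = 1` on points over the field with `3 ^ 3 ^ m` elements, and a Hensel argument
lifts all these points to `3`-adic points of period `n = 2 * 3 ^ m` of `g`. Above such a point,
periodicity forces `z = (∑ 2 ^ (n - 1 - k) y_k) / (2 ^ n - 1)`. The numerator is
`tr x - tr y` modulo `3` and `3 ^ (m + 1)` divides the denominator, so for two thirds of the points
`|z|₃` is at least `3 ^ m`, and most of these points avoid any given hypersurface. As there are
at most `3 ^ n` points of period `n` altogether, some Galois orbit contains a positive proportion
of conjugates with large `3`-adic absolute value, and this bounds its height from below.
-/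

namespace AffineDyn

section GenericZeros

open Polynomial

variable {K : Type*} [Field K]

lemma resultant_derivative_ne_zero_iff [CharZero K] {p : K[X]} (hp : p ≠ 0) :
    p.resultant (derivative p) p.natDegree (p.natDegree - 1) ≠ 0 ↔ p.Separable := by
  rw [← natDegree_derivative, Ne, resultant_eq_zero_iff, Polynomial.Separable]
  tauto

lemma encard_zeros_of_separable [IsAlgClosed K] {p : K[X]} (hp : p.Separable) :
    {t | p.eval t = 0}.encard = p.natDegree := by
  have hset : {t | p.eval t = 0} = p.rootSet K := by
    ext t
    simp [mem_rootSet, hp.ne_zero]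
  rw [hset, Set.encard_eq_coe_toFinset_card, Set.toFinset_card,
    card_rootSet_eq_natDegree hp (IsAlgClosed.splits _)]

lemma exists_separable_C_add [CharZero K] [IsAlgClosed K] (p : K[X]) :
    ∃ c, (C c + p).Separable := by
  classical
  by_cases hp : derivative p = 0
  · refine ⟨1 - p.coeff 0, ?_⟩
    rw [eq_C_of_natDegree_eq_zero (derivative_eq_zero.1 hp), coeff_C_zero, ← C_add,
      sub_add_cancel, C_1]
    exact separable_one
  · obtain ⟨c, hc⟩ := Infinite.exists_notMem_finset ((derivative p).roots.toFinset.image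
      fun t => -p.eval t)
    refine ⟨c, ?_⟩
    rw [Polynomial.Separable, isCoprime_iff_aeval_ne_zero_of_isAlgClosed K K]
    by_contra! h
    obtain ⟨t, ht, ht'⟩ := h
    simp only [map_add, derivative_C, zero_add, coe_aeval_eq_eval, eval_C] at ht ht'
    exact hc (Finset.mem_image.2 ⟨t, by simpa [hp] using ht', by linear_combination -ht⟩)

lemma exists_generic_encard_zeros [CharZero K] [IsAlgClosed K] {τ : Type*} {D : ℕ}
    {Q : (MvPolynomial τ K)[X]} (hQ : Q.natDegree ≤ D) {a₀ : τ → K}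
    (hdeg : (Q.map (MvPolynomial.eval a₀)).natDegree = D)
    (hsep : (Q.map (MvPolynomial.eval a₀)).Separable) :
    ∃ Φ : MvPolynomial τ K, Φ ≠ 0 ∧ ∀ a, MvPolynomial.eval a Φ ≠ 0 →
      {t | (Q.map (MvPolynomial.eval a)).eval t = 0}.encard = D := by
  have heval (a : τ → K) : MvPolynomial.eval a (Q.coeff D * Q.resultant (derivative Q) D (D - 1)) =
      (Q.map (MvPolynomial.eval a)).coeff D * (Q.map (MvPolynomial.eval a)).resultant
        (derivative (Q.map (MvPolynomial.eval a))) D (D - 1) := by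
    rw [map_mul, coeff_map, derivative_map, resultant_map_map]
  refine ⟨Q.coeff D * Q.resultant (derivative Q) D (D - 1), fun h0 => ?_, fun a ha => ?_⟩
  · refine mul_ne_zero ?_ ?_ ((heval a₀).symm.trans (h0 ▸ map_zero _))
    · rw [← hdeg]
      exact leadingCoeff_ne_zero.2 hsep.ne_zero
    · rw [← hdeg]
      exact (resultant_derivative_ne_zero_iff hsep.ne_zero).2 hsep
  · rw [heval] at ha
    have hcoeff := left_ne_zero_of_mul ha
    have hdeg : (Q.map (MvPolynomial.eval a)).natDegree = D :=
      natDegree_eq_of_le_of_coeff_ne_zero (natDegree_map_le.trans hQ) hcoeff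
    have hres := right_ne_zero_of_mul ha
    rw [← hdeg, resultant_derivative_ne_zero_iff fun h => hcoeff (by rw [h, coeff_zero])] at hres
    rw [encard_zeros_of_separable hres, hdeg]

end GenericZeros

section HomogenizedAeval

open MvPolynomial

variable {k σ : Type*} [CommRing k]

lemma coeff_aeval_C_mul_X (F : MvPolynomial σ k) (v : σ → k) (d : ℕ) :
    (aeval (fun i => Polynomial.C (v i) * Polynomial.X) F).coeff d =
      eval v (homogeneousComponent d F) := by
  classical
  rw [homogeneousComponent_apply, map_sum, aeval_def, eval₂_eq, Polynomial.finsetSum_coeff,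
    Finset.sum_filter]
  refine Finset.sum_congr rfl fun s _ => ?_
  simp only [mul_pow, Finset.prod_mul_distrib, Finset.prod_pow_eq_pow_sum, ← Polynomial.C_pow,
    ← map_prod, Polynomial.algebraMap_eq, ← mul_assoc, ← map_mul, Polynomial.coeff_C_mul_X_pow,
    eval_monomial, Finsupp.prod, Finsupp.degree_apply, eq_comm]

variable [Fintype σ]

/-- The value at `(δ, x)` of the homogenization of degree `D` of the polynomial `F`. The exponent
`D - s.degree` is truncated, so this is only meaningful if `F` has degree at most `D`. -/
noncomputable def homogenizedAeval {A : Type*} [CommRing A] [Algebra k A] (D : ℕ)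
    (F : MvPolynomial σ k) (δ : A) (x : σ → A) : A :=
  ∑ s ∈ F.support, algebraMap k A (F.coeff s) * (δ ^ (D - s.degree) * ∏ i, x i ^ s i)

lemma map_homogenizedAeval {A B : Type*} [CommRing A] [Algebra k A] [CommRing B] [Algebra k B]
    (φ : A →ₐ[k] B) (D : ℕ) (F : MvPolynomial σ k) (δ : A) (x : σ → A) :
    φ (homogenizedAeval D F δ x) = homogenizedAeval D F (φ δ) (φ ∘ x) := by
  simp [homogenizedAeval]

lemma homogenizedAeval_smul {A : Type*} [CommRing A] [Algebra k A] {D : ℕ} {F : MvPolynomial σ k}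
    (hF : F.totalDegree ≤ D) (δ : A) (x : σ → A) :
    homogenizedAeval D F δ (δ • x) = δ ^ D * aeval x F := by
  rw [homogenizedAeval, aeval_def, eval₂_eq', Finset.mul_sum]
  refine Finset.sum_congr rfl fun s hs => ?_
  have hsD : s.degree ≤ D := (le_totalDegree hs).trans hF
  simp only [Pi.smul_apply, smul_eq_mul, mul_pow, Finset.prod_mul_distrib,
    Finset.prod_pow_eq_pow_sum, ← Finsupp.degree_eq_sum]
  rw [← pow_sub_mul_pow δ hsD]
  ring

lemma homogenizedAeval_one {A : Type*} [CommRing A] [Algebra k A] {D : ℕ} {F : MvPolynomial σ k}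
    (hF : F.totalDegree ≤ D) (x : σ → A) : homogenizedAeval D F 1 x = aeval x F := by
  simpa using homogenizedAeval_smul hF 1 x

lemma natDegree_homogenizedAeval_le {A : Type*} [CommRing A] [Algebra k A] {D : ℕ}
    {F : MvPolynomial σ k} (hF : F.totalDegree ≤ D) (δ : A) {x : σ → Polynomial A}
    (hx : ∀ i, (x i).natDegree ≤ 1) :
    (homogenizedAeval D F (Polynomial.C δ) x).natDegree ≤ D := by
  refine Polynomial.natDegree_sum_le_of_forall_le _ _ fun s hs => ?_
  rw [IsScalarTower.algebraMap_apply k A, Polynomial.algebraMap_eq, ← Polynomial.C_pow]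
  refine (Polynomial.natDegree_C_mul_le _ _).trans ((Polynomial.natDegree_C_mul_le _ _).trans ?_)
  refine (Polynomial.natDegree_prod_le _ _).trans (le_trans ?_ ((le_totalDegree hs).trans hF))
  rw [Finsupp.sum, ← Finsupp.degree_apply, Finsupp.degree_eq_sum]
  exact Finset.sum_le_sum fun i _ => Polynomial.natDegree_pow_le_of_le (s i) (hx i) |>.trans
    (mul_one _).le

end HomogenizedAeval

section HasDegreeOne

open Matrix

variable {n : ℕ}

section

variable {A B : Type*} [CommRing A] [CommRing B]

/-- The matrix of the linear forms `x₀, ℓ₁, …, ℓₙ`, where `ℓᵢ` is the linear part of the affine form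
of index `i` with coefficients `a`. -/
def lineMatrix (a : Fin (n + 1) × Option (Fin (n + 1)) → A) :
    Matrix (Fin (n + 1)) (Fin (n + 1)) A :=
  Matrix.of (Fin.cons (Pi.single 0 1) fun i j => a (i.succ, some j))

/-- The line where the affine forms of positive index with coefficients `a` vanish, parametrized by
the coordinate `x₀` and multiplied by the common denominator `det (lineMatrix a)`. -/
noncomputable def lineParam (a : Fin (n + 1) × Option (Fin (n + 1)) → A) :
    Fin (n + 1) → Polynomial A :=
  (lineMatrix a).adjugate.map Polynomial.C *ᵥ
    Fin.cons Polynomial.X fun i => -Polynomial.C (a (i.succ, none))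

lemma lineMatrix_map (φ : A →+* B) (a : Fin (n + 1) × Option (Fin (n + 1)) → A) :
    lineMatrix (φ ∘ a) = φ.mapMatrix (lineMatrix a) := by
  ext i j
  refine Fin.cases ?_ (fun i => rfl) i
  simp [lineMatrix, Pi.single_apply, apply_ite φ]

lemma lineParam_map (φ : A →+* B) (a : Fin (n + 1) × Option (Fin (n + 1)) → A) :
    lineParam (φ ∘ a) = Polynomial.mapRingHom φ ∘ lineParam a := by
  rw [lineParam, lineMatrix_map, ← RingHom.map_adjugate]
  ext1 i
  simp [lineParam, mulVec, dotProduct, Fin.sum_univ_succ, Polynomial.map_sum]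

lemma natDegree_lineParam_le (a : Fin (n + 1) × Option (Fin (n + 1)) → A) (i : Fin (n + 1)) :
    (lineParam a i).natDegree ≤ 1 := by
  simp only [lineParam, mulVec, dotProduct, map_apply]
  refine Polynomial.natDegree_sum_le_of_forall_le _ _ fun j _ => ?_
  refine (Polynomial.natDegree_C_mul_le _ _).trans ?_
  cases j using Fin.cases <;> simp [Polynomial.natDegree_X_le]

lemma lineMatrix_mulVec_lineParam (a : Fin (n + 1) × Option (Fin (n + 1)) → A) (t : A) :
    lineMatrix a *ᵥ (fun i => (lineParam a i).eval t) =
      (lineMatrix a).det • Fin.cons t fun i => -a (i.succ, none) := by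
  have heval : (fun i => (lineParam a i).eval t) =
      (lineMatrix a).adjugate *ᵥ Fin.cons t fun i => -a (i.succ, none) := by
    ext i
    simp [lineParam, mulVec, dotProduct, Fin.sum_univ_succ, Polynomial.eval_finsetSum]
  rw [heval, mulVec_mulVec, mul_adjugate, smul_mulVec, one_mulVec]

end

lemma lineMatrix_mulVec_eq_iff {a : Fin (n + 1) × Option (Fin (n + 1)) → Qbar}
    {x : Fin (n + 1) → Qbar} {t : Qbar} :
    lineMatrix a *ᵥ x = Fin.cons t (fun i => -a (i.succ, none)) ↔
      x 0 = t ∧ ∀ i : Fin (n + 1), 1 ≤ i.val → affineForm a i x = 0 := by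
  simp [funext_iff, Fin.forall_fin_succ, lineMatrix, mulVec, dotProduct, affineForm,
    eq_neg_iff_add_eq_zero, add_comm, Pi.single_apply]

lemma lineMatrix_mulVec_eq_iff_eq_lineParam {a : Fin (n + 1) × Option (Fin (n + 1)) → Qbar}
    (ha : (lineMatrix a).det ≠ 0) {x : Fin (n + 1) → Qbar} {t : Qbar} :
    lineMatrix a *ᵥ x = Fin.cons t (fun i => -a (i.succ, none)) ↔
      (lineMatrix a).det • x = fun i => (lineParam a i).eval t := by
  have hinj := mulVec_injective_of_isUnit ((isUnit_iff_isUnit_det (lineMatrix a)).2 ha.isUnit)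
  rw [← hinj.eq_iff (a := _ • x), lineMatrix_mulVec_lineParam, mulVec_smul, smul_right_inj ha]

/-- The affine form of index `0` with coefficients `a`, pulled back under `F` and restricted to the
line `lineParam a`, multiplied by the `D`-th power of the common denominator. -/
noncomputable def linePullback {k A : Type*} [CommRing k] [CommRing A] [Algebra k A] (D : ℕ)
    (F : Fin (n + 1) → MvPolynomial (Fin (n + 1)) k) (a : Fin (n + 1) × Option (Fin (n + 1)) → A) :
    Polynomial A :=
  Polynomial.C (a (0, none) * (lineMatrix a).det ^ D) + ∑ j, Polynomial.C (a (0, some j)) *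
    homogenizedAeval D (F j) (Polynomial.C (lineMatrix a).det) (lineParam a)

section

variable {k : Type*} [CommRing k] {D : ℕ} {F : Fin (n + 1) → MvPolynomial (Fin (n + 1)) k}

lemma linePullback_map {A B : Type*} [CommRing A] [Algebra k A] [CommRing B] [Algebra k B]
    (φ : A →ₐ[k] B) (a : Fin (n + 1) × Option (Fin (n + 1)) → A) :
    linePullback D F (φ ∘ a) = (linePullback D F a).map (φ : A →+* B) := by
  have hhom (j : Fin (n + 1)) := map_homogenizedAeval (Polynomial.mapAlgHom φ) D (F j)
    (Polynomial.C (lineMatrix a).det) (lineParam a)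
  have hdet : (lineMatrix (φ ∘ a)).det = φ (lineMatrix a).det := by
    rw [← RingHom.coe_coe, lineMatrix_map, RingHom.map_det]
  have hline : lineParam (φ ∘ a) = Polynomial.mapAlgHom φ ∘ lineParam a :=
    lineParam_map (φ : A →+* B) a
  simp only [Polynomial.coe_mapAlgHom, Polynomial.map_C, RingHom.coe_coe] at hhom hline
  simp [linePullback, hdet, hline, hhom, Polynomial.map_sum]

lemma natDegree_linePullback_le {A : Type*} [CommRing A] [Algebra k A]
    (hF : ∀ j, (F j).totalDegree ≤ D) (a : Fin (n + 1) × Option (Fin (n + 1)) → A) :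
    (linePullback D F a).natDegree ≤ D := by
  refine (Polynomial.natDegree_add_le _ _).trans
    (max_le ((Polynomial.natDegree_C _).trans_le D.zero_le) ?_)
  refine Polynomial.natDegree_sum_le_of_forall_le _ _ fun j _ => ?_
  exact (Polynomial.natDegree_C_mul_le _ _).trans
    (natDegree_homogenizedAeval_le (hF j) _ (natDegree_lineParam_le a))

end

lemma eval_linePullback {D : ℕ} {F : Fin (n + 1) → MvPolynomial (Fin (n + 1)) Qbar}
    (hF : ∀ j, (F j).totalDegree ≤ D) {a : Fin (n + 1) × Option (Fin (n + 1)) → Qbar}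
    {x : Fin (n + 1) → Qbar} {t : Qbar}
    (hx : (lineMatrix a).det • x = fun i => (lineParam a i).eval t) :
    (linePullback D F a).eval t = (lineMatrix a).det ^ D * affineForm a 0 (onPoints F x) := by
  have hhom (j : Fin (n + 1)) := map_homogenizedAeval (Polynomial.aeval t) D (F j)
    (Polynomial.C (lineMatrix a).det) (lineParam a)
  simp only [Polynomial.coe_aeval_eq_eval, Polynomial.eval_C, Function.comp_def, ← hx,
    homogenizedAeval_smul (hF _)] at hhom
  simp only [linePullback, Polynomial.eval_add, Polynomial.eval_C, Polynomial.eval_finsetSum,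
    Polynomial.eval_mul, hhom, affineForm, onPoints, mul_add, Finset.mul_sum]
  congr 1
  · ring
  · exact Finset.sum_congr rfl fun j _ => by ring

lemma exists_lineParam_eq {A : Type*} [CommRing A] {v : Fin (n + 1) → A} (hv : v 0 = 1)
    (ℓ : Option (Fin (n + 1)) → A) :
    ∃ a : Fin (n + 1) × Option (Fin (n + 1)) → A, (∀ o, a (0, o) = ℓ o) ∧ (lineMatrix a).det = 1 ∧
      lineParam a = fun i => Polynomial.C (v i) * Polynomial.X := by
  let a : Fin (n + 1) × Option (Fin (n + 1)) → A := fun p =>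
    (Fin.cons ℓ fun i o => o.elim 0 (Fin.cons (-v i.succ) (Pi.single i 1)) :
      Fin (n + 1) → Option (Fin (n + 1)) → A) p.1 p.2
  have hdet : (lineMatrix a).det = 1 := by
    rw [det_of_isLowerTriangular, Fin.prod_univ_succ]
    · simp [lineMatrix, a]
    · intro i j (hij : i < j)
      cases i using Fin.cases <;> cases j using Fin.cases <;>
        simp_all [lineMatrix, a, ne_of_gt]
  refine ⟨a, fun o => rfl, hdet, ?_⟩
  have hline : (Fin.cons Polynomial.X fun i => -Polynomial.C (a (i.succ, none))) =
      (lineMatrix a).map Polynomial.C *ᵥ fun i => Polynomial.C (v i) * Polynomial.X := by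
    ext1 i
    cases i using Fin.cases <;>
      simp [lineMatrix, a, mulVec, dotProduct, Fin.sum_univ_succ, hv, Pi.single_apply, apply_ite]
  rw [lineParam, hline, mulVec_mulVec, ← Matrix.map_mul, adjugate_mul, hdet, one_smul]
  simp

lemma eval_smul_of_isHomogeneous {R : Type*} [CommRing R] {d : ℕ}
    {P : MvPolynomial (Fin n) R} (hP : P.IsHomogeneous d) (c : R) (v : Fin n → R) :
    MvPolynomial.eval (c • v) P = c ^ d * MvPolynomial.eval v P := by
  simp only [MvPolynomial.eval_eq', Finset.mul_sum]
  refine Finset.sum_congr rfl fun s hs => ?_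
  simp only [Pi.smul_apply, smul_eq_mul, mul_pow, Finset.prod_mul_distrib,
    Finset.prod_pow_eq_pow_sum, ← Finsupp.degree_eq_sum]
  have hs : s.degree = d := by
    rw [Finsupp.degree_eq_weight_one]
    exact hP (MvPolynomial.mem_support_iff.1 hs)
  rw [hs]
  ring

lemma exists_eval_ne_zero_of_isHomogeneous {K : Type*} [Field K] [Infinite K] {d : ℕ}
    {P : MvPolynomial (Fin (n + 1)) K} (hP : P.IsHomogeneous d) (hP0 : P ≠ 0) :
    ∃ v : Fin (n + 1) → K, v 0 = 1 ∧ MvPolynomial.eval v P ≠ 0 := by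
  obtain ⟨v, hv⟩ : ∃ v, MvPolynomial.eval v (MvPolynomial.X 0 * P) ≠ 0 := by
    by_contra! h
    exact mul_ne_zero (MvPolynomial.X_ne_zero 0) hP0 (MvPolynomial.funext fun v => by simp [h])
  rw [map_mul, MvPolynomial.eval_X] at hv
  have hv0 := left_ne_zero_of_mul hv
  refine ⟨(v 0)⁻¹ • v, inv_mul_cancel₀ hv0, ?_⟩
  rw [eval_smul_of_isHomogeneous hP]
  exact mul_ne_zero (pow_ne_zero _ (inv_ne_zero hv0)) (right_ne_zero_of_mul hv)

lemma exists_natDegree_aeval_eq_totalDegree {K : Type*} [Field K] [Infinite K]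
    (F : MvPolynomial (Fin (n + 1)) K) :
    ∃ v : Fin (n + 1) → K, v 0 = 1 ∧ (MvPolynomial.aeval
      (fun i => Polynomial.C (v i) * Polynomial.X) F).natDegree = F.totalDegree := by
  rcases eq_or_ne F 0 with rfl | hF
  · exact ⟨1, rfl, by simp⟩
  have htop : MvPolynomial.homogeneousComponent F.totalDegree F ≠ 0 := by
    obtain ⟨s, hs, hsF⟩ := Finset.exists_mem_eq_sup F.support
      (MvPolynomial.support_nonempty.2 hF) fun s => s.sum fun _ e => e
    refine MvPolynomial.ne_zero_iff.2 ⟨s, ?_⟩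
    rw [MvPolynomial.coeff_homogeneousComponent,
      if_pos (show s.degree = F.totalDegree from hsF.symm)]
    exact MvPolynomial.mem_support_iff.1 hs
  obtain ⟨v, hv0, hv⟩ := exists_eval_ne_zero_of_isHomogeneous
    (MvPolynomial.homogeneousComponent_isHomogeneous F.totalDegree F) htop
  refine ⟨v, hv0, Polynomial.natDegree_eq_of_le_of_coeff_ne_zero ?_ ?_⟩
  · rw [← homogenizedAeval_one le_rfl, ← Polynomial.C_1]
    exact natDegree_homogenizedAeval_le le_rfl 1 fun i =>
      (Polynomial.natDegree_C_mul_le _ _).trans Polynomial.natDegree_X_le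
  · rwa [coeff_aeval_C_mul_X]

lemma exists_separable_linePullback {K : Type} [Field K] [CharZero K] [IsAlgClosed K]
    (F : Fin (n + 1) → MvPolynomial (Fin (n + 1)) K) :
    ∃ a : Fin (n + 1) × Option (Fin (n + 1)) → K,
      (linePullback (degree F) F a).natDegree = degree F ∧
        (linePullback (degree F) F a).Separable := by
  obtain ⟨j, -, hj⟩ := Finset.exists_mem_eq_sup Finset.univ Finset.univ_nonempty
    fun i => (F i).totalDegree
  obtain ⟨v, hv0, hv⟩ := exists_natDegree_aeval_eq_totalDegree (F j)
  have hjD : (F j).totalDegree ≤ degree F := hj.ge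
  obtain ⟨c, hc⟩ := exists_separable_C_add
    (MvPolynomial.aeval (fun i => Polynomial.C (v i) * Polynomial.X) (F j))
  obtain ⟨a, ha, hdet, hline⟩ := exists_lineParam_eq hv0 fun o => o.elim c (Pi.single j 1)
  have hpull : linePullback (degree F) F a = Polynomial.C c +
      MvPolynomial.aeval (fun i => Polynomial.C (v i) * Polynomial.X) (F j) := by
    simp [linePullback, ha, hdet, hline, Pi.single_apply, apply_ite, ite_mul,
      homogenizedAeval_one hjD]
  refine ⟨a, ?_⟩
  rw [hpull, Polynomial.natDegree_C_add]
  exact ⟨hv.trans hj.symm, hc⟩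

lemma encard_setOf_affineForm_eq_zero {D : ℕ} {F : Fin (n + 1) → MvPolynomial (Fin (n + 1)) Qbar}
    (hF : ∀ j, (F j).totalDegree ≤ D) {a : Fin (n + 1) × Option (Fin (n + 1)) → Qbar}
    (ha : (lineMatrix a).det ≠ 0) :
    {x | (∀ i : Fin (n + 1), i.val < 1 → affineForm a i (onPoints F x) = 0) ∧
      ∀ i : Fin (n + 1), 1 ≤ i.val → affineForm a i x = 0}.encard =
      {t | (linePullback D F a).eval t = 0}.encard := by
  have hpt {x t} := lineMatrix_mulVec_eq_iff_eq_lineParam ha (x := x) (t := t)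
  refine Set.encard_congr (Set.BijOn.equiv (fun x => x 0) ⟨?_, ?_, ?_⟩)
  · rintro x ⟨hx, hxa⟩
    rw [Set.mem_ofPred, eval_linePullback hF (hpt.1 (lineMatrix_mulVec_eq_iff.2 ⟨rfl, hxa⟩)),
      hx 0 one_pos, mul_zero]
  · rintro x ⟨-, hx⟩ y ⟨-, hy⟩ (hxy : x 0 = y 0)
    have hx := hpt.1 (lineMatrix_mulVec_eq_iff.2 ⟨hxy, hx⟩)
    rw [← hpt.1 (lineMatrix_mulVec_eq_iff.2 ⟨rfl, hy⟩)] at hx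
    exact smul_right_injective _ ha hx
  · intro t ht
    obtain ⟨x, hx⟩ : ∃ x, (lineMatrix a).det • x = fun i => (lineParam a i).eval t :=
      ⟨_, smul_inv_smul₀ ha _⟩
    obtain ⟨hx0, hxa⟩ := lineMatrix_mulVec_eq_iff.1 (hpt.2 hx)
    rw [Set.mem_ofPred, eval_linePullback hF hx] at ht
    refine ⟨x, ⟨fun i hi => ?_, hxa⟩, hx0⟩
    obtain rfl : i = 0 := Fin.ext (Nat.lt_one_iff.1 hi)
    exact (mul_eq_zero.1 ht).resolve_left (pow_ne_zero _ ha)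

theorem hasDegree_one_Qbar (F : Fin (n + 1) → MvPolynomial (Fin (n + 1)) Qbar) :
    HasDegree (onPoints F) 1 (degree F) := by
  have hF (j : Fin (n + 1)) : (F j).totalDegree ≤ degree F :=
    Finset.le_sup (f := fun j => (F j).totalDegree) (Finset.mem_univ j)
  have hmap (a : Fin (n + 1) × Option (Fin (n + 1)) → Qbar) :
      (linePullback (degree F) F MvPolynomial.X).map (MvPolynomial.eval a) =
        linePullback (degree F) F a := by
    rw [← MvPolynomial.coe_aeval_eq_eval, ← linePullback_map]
    congr 1
    exact funext fun p => MvPolynomial.aeval_X a p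
  have hdet (a : Fin (n + 1) × Option (Fin (n + 1)) → Qbar) :
      MvPolynomial.eval a (lineMatrix MvPolynomial.X).det = (lineMatrix a).det := by
    rw [RingHom.map_det, ← lineMatrix_map]
    congr 2
    exact funext fun p => MvPolynomial.eval_X p
  obtain ⟨a₀, hdeg, hsep⟩ := exists_separable_linePullback F
  obtain ⟨Φ, hΦ, hcard⟩ := exists_generic_encard_zeros (natDegree_linePullback_le hF MvPolynomial.X)
    (hmap a₀ ▸ hdeg) (hmap a₀ ▸ hsep)
  have hdet0 : (lineMatrix (n := n) (MvPolynomial.X (R := Qbar))).det ≠ 0 := fun h => by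
    obtain ⟨a, -, ha, -⟩ := exists_lineParam_eq (n := n) (v := 1) rfl fun _ => (0 : Qbar)
    simpa [h, ha] using hdet a
  refine ⟨_, mul_ne_zero hdet0 hΦ, fun a ha => ?_⟩
  rw [map_mul, hdet] at ha
  rw [← hcard a (right_ne_zero_of_mul ha), hmap]
  exact encard_setOf_affineForm_eq_zero hF (left_ne_zero_of_mul ha)

end HasDegreeOne

section PolynomialMaps

open MvPolynomial

variable {N : ℕ} {k K : Type} [Field k] [Field K]

lemma isAutomorphism_iff_exists_inverse {F : Fin N → MvPolynomial (Fin N) k} :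
    IsAutomorphism F ↔ ∃ G : Fin N → MvPolynomial (Fin N) k,
      (∀ i, aeval F (G i) = X i) ∧ ∀ i, aeval G (F i) = X i := by
  refine ⟨fun h => ?_, fun ⟨G, hFG, hGF⟩ => ?_⟩
  · choose G hG using fun i => h.2 (X i)
    refine ⟨G, hG, fun i => h.1 ?_⟩
    have hcomp : (aeval F).comp (aeval G) = AlgHom.id k _ := algHom_ext fun i => by simpa using hG i
    simpa using DFunLike.congr_fun hcomp (F i)
  · have hFG : (aeval F).comp (aeval G) = AlgHom.id k _ := algHom_ext fun i => by simpa using hFG i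
    have hGF : (aeval G).comp (aeval F) = AlgHom.id k _ := algHom_ext fun i => by simpa using hGF i
    exact (AlgEquiv.ofAlgHom _ _ hFG hGF).bijective

lemma IsAutomorphism.map [Algebra k K] {F : Fin N → MvPolynomial (Fin N) k}
    (hF : IsAutomorphism F) : IsAutomorphism fun i => MvPolynomial.map (algebraMap k K) (F i) := by
  obtain ⟨G, hFG, hGF⟩ := isAutomorphism_iff_exists_inverse.1 hF
  have haeval (P Q : Fin N → MvPolynomial (Fin N) k) (i : Fin N) :
      aeval (fun j => MvPolynomial.map (algebraMap k K) (P j))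
        (MvPolynomial.map (algebraMap k K) (Q i)) =
      MvPolynomial.map (algebraMap k K) (aeval P (Q i)) := by
    rw [aeval_map_algebraMap]
    exact (comp_aeval_apply _ (mapAlgHom (Algebra.ofId k K)) (Q i)).symm
  exact isAutomorphism_iff_exists_inverse.2 ⟨fun i => MvPolynomial.map (algebraMap k K) (G i),
    fun i => by rw [haeval, hFG, map_X], fun i => by rw [haeval, hGF, map_X]⟩

lemma degree_map [Algebra k K] (F : Fin N → MvPolynomial (Fin N) k) :
    degree (fun i => MvPolynomial.map (algebraMap k K) (F i)) = degree F := by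
  simp only [degree, totalDegree,
    support_map_of_injective _ (FaithfulSMul.algebraMap_injective k K)]

variable [Algebra k Qbar]

lemma onPoints_map (F : Fin N → MvPolynomial (Fin N) k) :
    onPoints (fun i => MvPolynomial.map (algebraMap k Qbar) (F i)) = onPoints F :=
  funext fun P => funext fun i => aeval_map_algebraMap Qbar P (F i)

lemma aeval_onPoints (F : Fin N → MvPolynomial (Fin N) k) (P : Fin N → Qbar)
    (p : MvPolynomial (Fin N) k) : aeval (onPoints F P) p = aeval P (aeval F p) :=
  (comp_aeval_apply _ (aeval P) p).symm

lemma onPoints_leftInverse {F G : Fin N → MvPolynomial (Fin N) k}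
    (hGF : ∀ i, aeval F (G i) = X i) : Function.LeftInverse (onPoints G) (onPoints F) :=
  fun P => funext fun i => by rw [onPoints, aeval_onPoints, hGF, aeval_X]

/-- The coordinate polynomials of the `n`-th iterate of `F`. -/
noncomputable def iterateCoords (F : Fin N → MvPolynomial (Fin N) k) :
    ℕ → Fin N → MvPolynomial (Fin N) k
  | 0 => X
  | n + 1 => fun i => aeval (iterateCoords F n) (F i)

lemma onPoints_iterateCoords (F : Fin N → MvPolynomial (Fin N) k) (n : ℕ) :
    onPoints (iterateCoords F n) = (onPoints F)^[n] := by
  induction n with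
  | zero => exact funext fun P => funext fun i => aeval_X P i
  | succ n ih =>
    rw [Function.iterate_succ', ← ih]
    exact funext fun P => funext fun i => by
      rw [onPoints, iterateCoords, ← aeval_onPoints, Function.comp_apply, onPoints]

theorem hasDegree_one {n : ℕ} (F : Fin (n + 1) → MvPolynomial (Fin (n + 1)) k) :
    HasDegree (onPoints F) 1 (degree F) := by
  rw [← onPoints_map, ← degree_map (K := Qbar)]
  exact hasDegree_one_Qbar _

end PolynomialMaps

open MvPolynomial in
lemma HasDegree.of_inverse {N p d : ℕ} {φ ψ : (Fin N → Qbar) → (Fin N → Qbar)} (hp : p ≤ N)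
    (hl : Function.LeftInverse ψ φ) (hr : Function.RightInverse ψ φ) (h : HasDegree φ p d) :
    HasDegree ψ (N - p) d := by
  obtain ⟨Φ, hΦ, h⟩ := h
  refine ⟨rename (Prod.map Fin.rev id) Φ, ?_, fun a ha => ?_⟩
  · rwa [Ne, map_eq_zero_iff _
      (rename_injective _ (Fin.rev_injective.prodMap Function.injective_id))]
  · rw [eval_rename] at ha
    rw [← h _ ha, ← hr.injective.encard_image]
    congr 1
    ext x
    have hrev (i : Fin N) : i.rev.val < p ↔ N - p ≤ i.val := by
      rw [Fin.val_rev]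
      omega
    rw [Set.mem_image_iff_of_inverse hr hl, Set.mem_ofPred_eq, Set.mem_ofPred_eq, and_comm, hl x]
    refine and_congr ?_ ?_ <;> rw [Fin.rev_surjective.forall]
    · simp only [← hrev, Fin.rev_rev]
      rfl
    · simp only [← not_le, ← hrev, Fin.rev_rev, not_not]
      rfl

lemma hasDynamicalDegree_of_pow {N : ℕ} {φ : (Fin N → Qbar) → (Fin N → Qbar)} {p d : ℕ}
    (h : ∀ n, HasDegree φ^[n] p (d ^ n)) : HasDynamicalDegree φ p d := by
  refine ⟨fun n => d ^ n, h, tendsto_const_nhds.congr' ?_⟩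
  filter_upwards [eventually_ne_atTop 0] with n hn
  rw [Nat.cast_pow, one_div, Real.pow_rpow_inv_natCast (Nat.cast_nonneg d) hn]

section DegreesOfIterates

open MvPolynomial

/-- The coordinate polynomials of the inverse of `f`. -/
noncomputable def fInv : Fin 3 → MvPolynomial (Fin 3) ℚ :=
  ![X 1 - X 0 + X 0 ^ 3, X 0, C 2⁻¹ * (X 2 + X 0)]

lemma aeval_f_apply {A : Type*} [CommRing A] [Algebra ℚ A] (x : Fin 3 → A) (i : Fin 3) :
    aeval x (f i) = ![x 1, x 0 + x 1 - x 1 ^ 3, 2 * x 2 - x 1] i := by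
  fin_cases i <;> simp [f]

lemma aeval_fInv_apply {A : Type*} [CommRing A] [Algebra ℚ A] (x : Fin 3 → A) (i : Fin 3) :
    aeval x (fInv i) = ![x 1 - x 0 + x 0 ^ 3, x 0, algebraMap ℚ A 2⁻¹ * (x 2 + x 0)] i := by
  fin_cases i <;> simp [fInv, algHom_C]

lemma algebraMap_two_inv_mul_two {A : Type*} [CommRing A] [Algebra ℚ A] :
    algebraMap ℚ A 2⁻¹ * 2 = 1 := by
  rw [← map_ofNat (algebraMap ℚ A) 2, ← map_mul, inv_mul_cancel₀ two_ne_zero, map_one]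

lemma aeval_f_fInv (i : Fin 3) : aeval f (fInv i) = X i := by
  rw [aeval_fInv_apply]
  fin_cases i <;> simp only [f, Fin.reduceFinMk, Fin.zero_eta, Fin.mk_one, Matrix.cons_val]
  · ring
  · linear_combination (X 2) * algebraMap_two_inv_mul_two (A := MvPolynomial (Fin 3) ℚ)

lemma aeval_fInv_f (i : Fin 3) : aeval fInv (f i) = X i := by
  rw [aeval_f_apply]
  fin_cases i <;> simp only [fInv, ← algebraMap_eq, Fin.reduceFinMk, Fin.zero_eta, Fin.mk_one,
    Matrix.cons_val]
  · ring
  · linear_combination (X 2 + X 0) * algebraMap_two_inv_mul_two (A := MvPolynomial (Fin 3) ℚ)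

lemma isAutomorphism_f : IsAutomorphism f :=
  isAutomorphism_iff_exists_inverse.2 ⟨fInv, aeval_f_fInv, aeval_fInv_f⟩

lemma totalDegree_add_pow {R σ : Type*} [CommRing R] [IsDomain R] {m : ℕ} (hm : 1 < m)
    {p q : MvPolynomial σ R} (hq : 0 < q.totalDegree) (hpq : p.totalDegree ≤ q.totalDegree) :
    (p + q ^ m).totalDegree = m * q.totalDegree := by
  have hq0 : q ≠ 0 := by
    rintro rfl
    exact hq.ne' totalDegree_zero
  have hpow (n : ℕ) : (q ^ n).totalDegree = n * q.totalDegree := by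
    induction n with
    | zero => simp
    | succ n ih =>
      rw [pow_succ, totalDegree_mul_of_isDomain (pow_ne_zero n hq0) hq0, ih, add_one_mul]
  rw [totalDegree_add_eq_right_of_totalDegree_lt, hpow]
  rw [hpow]
  nlinarith

lemma degree_eq_of_forall_le {N d : ℕ} {k : Type} [Field k] {F : Fin N → MvPolynomial (Fin N) k}
    {i : Fin N} (hi : (F i).totalDegree = d) (h : ∀ j, (F j).totalDegree ≤ d) : degree F = d :=
  le_antisymm (Finset.sup_le fun j _ => h j)
    (hi ▸ Finset.le_sup (f := fun j => (F j).totalDegree) (Finset.mem_univ i))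

lemma totalDegree_iterateCoords_f (n : ℕ) : (iterateCoords f n 1).totalDegree = 3 ^ n ∧
    ∀ i, (iterateCoords f n i).totalDegree ≤ 3 ^ n := by
  induction n with
  | zero => simp [iterateCoords]
  | succ n ih =>
    obtain ⟨h1, h⟩ := ih
    have hle : 3 ^ n ≤ 3 ^ (n + 1) := Nat.pow_le_pow_right three_pos n.le_succ
    have hneg : (-iterateCoords f n 1).totalDegree = 3 ^ n := by rw [totalDegree_neg, h1]
    have hcube : (iterateCoords f n 0 + iterateCoords f n 1 - iterateCoords f n 1 ^ 3).totalDegree =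
        3 ^ (n + 1) := by
      rw [sub_eq_add_neg, ← Odd.neg_pow (by decide), totalDegree_add_pow (by norm_num), hneg,
        pow_succ']
      · exact hneg ▸ Nat.pow_pos three_pos
      · exact hneg ▸ (totalDegree_add _ _).trans (max_le (h 0) (h 1))
    have htwo : (2 * iterateCoords f n 2).totalDegree ≤ 3 ^ n := by
      rw [two_mul]
      exact (totalDegree_add _ _).trans (max_le (h 2) (h 2))
    simp only [iterateCoords, aeval_f_apply]
    refine ⟨hcube, Fin.forall_fin_succ.2 ⟨(h 1).trans hle, Fin.forall_fin_two.2 ⟨hcube.le, ?_⟩⟩⟩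
    exact (totalDegree_sub _ _).trans (max_le (htwo.trans hle) ((h 1).trans hle))

lemma totalDegree_iterateCoords_fInv (n : ℕ) : (iterateCoords fInv n 0).totalDegree = 3 ^ n ∧
    ∀ i, (iterateCoords fInv n i).totalDegree ≤ 3 ^ n := by
  induction n with
  | zero => simp [iterateCoords]
  | succ n ih =>
    obtain ⟨h0, h⟩ := ih
    have hle : 3 ^ n ≤ 3 ^ (n + 1) := Nat.pow_le_pow_right three_pos n.le_succ
    have hcube : (iterateCoords fInv n 1 - iterateCoords fInv n 0 +
        iterateCoords fInv n 0 ^ 3).totalDegree = 3 ^ (n + 1) := by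
      rw [totalDegree_add_pow (by norm_num), h0, pow_succ']
      · exact h0 ▸ Nat.pow_pos three_pos
      · exact h0 ▸ (totalDegree_sub _ _).trans (max_le (h 1) (h 0))
    simp only [iterateCoords, aeval_fInv_apply]
    refine ⟨hcube, Fin.forall_fin_succ.2 ⟨hcube.le, Fin.forall_fin_two.2 ⟨(h 0).trans hle, ?_⟩⟩⟩
    refine (totalDegree_mul _ _).trans ?_
    rw [algebraMap_eq, totalDegree_C, zero_add]
    exact ((totalDegree_add _ _).trans (max_le (h 2) (h 0))).trans hle

lemma hasDegree_one_onPoints_f_iterate (n : ℕ) : HasDegree (onPoints f)^[n] 1 (3 ^ n) := by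
  obtain ⟨h1, h⟩ := totalDegree_iterateCoords_f n
  rw [← onPoints_iterateCoords, ← degree_eq_of_forall_le h1 h]
  exact hasDegree_one _

lemma hasDegree_two_onPoints_f_iterate (n : ℕ) : HasDegree (onPoints f)^[n] 2 (3 ^ n) := by
  obtain ⟨h0, h⟩ := totalDegree_iterateCoords_fInv n
  have hinv : HasDegree (onPoints fInv)^[n] 1 (3 ^ n) := by
    rw [← onPoints_iterateCoords, ← degree_eq_of_forall_le h0 h]
    exact hasDegree_one _
  exact hinv.of_inverse (by norm_num) ((onPoints_leftInverse aeval_fInv_f).iterate n)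
    ((onPoints_leftInverse aeval_f_fInv).iterate n)

lemma degree_f : degree f = 3 := by
  obtain ⟨h1, h⟩ := totalDegree_iterateCoords_f 1
  exact (congrArg degree (funext fun i => (aeval_X_left_apply (f i)).symm)).trans
    (degree_eq_of_forall_le h1 h)

end DegreesOfIterates

section PowersInSpan

variable {R A ι : Type*} [CommRing R] [CommRing A] [Algebra R A] {d : ℕ}

lemma prod_pow_mem_span_of_pow_mem [Fintype ι] (hd : 2 ≤ d) {x : ι → A}
    (hx : ∀ i, x i ^ d ∈ Submodule.span R (Set.range x)) (β : ι →₀ ℕ) :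
    β.prod (fun i e => x i ^ e) ∈
      Submodule.span R (Set.range fun α : ι → Fin d => ∏ i, x i ^ (α i : ℕ)) := by
  classical
  induction hdeg : β.degree using Nat.strong_induction_on generalizing β with
  | _ m ih =>
    by_cases hβ : ∀ i, β i < d
    · rw [Finsupp.prod_fintype _ _ fun i => pow_zero (x i)]
      exact Submodule.subset_span ⟨fun i => ⟨β i, hβ i⟩, rfl⟩
    · push Not at hβ
      obtain ⟨i, hi⟩ := hβ
      obtain ⟨γ, rfl⟩ := exists_add_of_le (Finsupp.single_le_iff.2 hi)
      have hprod (δ : ι →₀ ℕ) : (δ + γ).prod (fun i e => x i ^ e) =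
          δ.prod (fun i e => x i ^ e) * γ.prod fun i e => x i ^ e :=
        Finsupp.prod_add_index' (fun i => pow_zero _) fun i => pow_add _
      have hsingle (j : ι) (e : ℕ) : (Finsupp.single j e).prod (fun i e => x i ^ e) = x j ^ e :=
        Finsupp.prod_single_index (pow_zero _)
      rw [map_add, Finsupp.degree_single] at hdeg
      rw [hprod, hsingle]
      refine Submodule.span_induction (p := fun w _ => w * _ ∈ _) ?_ (by simp)
        (fun u v _ _ hu hv => ?_) (fun c u _ hu => ?_) (hx i)
      · rintro _ ⟨j, rfl⟩
        have h := ih (1 + γ.degree) (by omega) (Finsupp.single j 1 + γ) (by simp)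
        rwa [hprod, hsingle, pow_one] at h
      · rw [add_mul]
        exact add_mem hu hv
      · rw [smul_mul_assoc]
        exact Submodule.smul_mem _ _ hu

lemma toSubmodule_adjoin_eq_span_of_pow_mem [Fintype ι] (hd : 2 ≤ d) {x : ι → A}
    (hx : ∀ i, x i ^ d ∈ Submodule.span R (Set.range x)) :
    Subalgebra.toSubmodule (Algebra.adjoin R (Set.range x)) =
      Submodule.span R (Set.range fun α : ι → Fin d => ∏ i, x i ^ (α i : ℕ)) := by
  refine le_antisymm (fun y hy => ?_) (Submodule.span_le.2 ?_)
  · rw [Algebra.adjoin_range_eq_range_aeval] at hy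
    obtain ⟨p, rfl⟩ := hy
    change MvPolynomial.aeval x p ∈ _
    rw [MvPolynomial.aeval_def, MvPolynomial.eval₂_eq]
    refine sum_mem fun β _ => ?_
    rw [← Algebra.smul_def]
    exact Submodule.smul_mem _ _ (prod_pow_mem_span_of_pow_mem hd hx β)
  · rintro _ ⟨α, rfl⟩
    exact (Algebra.adjoin R _).prod_mem fun i _ =>
      pow_mem (Algebra.subset_adjoin (Set.mem_range_self i)) _

lemma fg_adjoin_of_pow_mem [Finite ι] (hd : 2 ≤ d) {x : ι → A}
    (hx : ∀ i, x i ^ d ∈ Submodule.span R (Set.range x)) :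
    (Subalgebra.toSubmodule (Algebra.adjoin R (Set.range x))).FG := by
  have := Fintype.ofFinite ι
  rw [toSubmodule_adjoin_eq_span_of_pow_mem hd hx]
  exact Submodule.fg_span (Set.finite_range _)

lemma isIntegral_of_pow_mem [Finite ι] (hd : 2 ≤ d) {x : ι → A}
    (hx : ∀ i, x i ^ d ∈ Submodule.span R (Set.range x)) (i : ι) : IsIntegral R (x i) :=
  .of_mem_of_fg _ (fg_adjoin_of_pow_mem hd hx) _ (Algebra.subset_adjoin (Set.mem_range_self i))

-- The evaluations at the points of `T` are distinct characters of the algebra generated by the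
-- `x i`, and this algebra has dimension at most `d ^ card ι`.
lemma finite_and_card_le_of_pow_mem [Fintype ι] {k T : Type*} [Field k] (hd : 2 ≤ d) {x : ι → T → k}
    (hsep : ∀ P Q : T, (∀ i, x i P = x i Q) → P = Q)
    (hx : ∀ i, x i ^ d ∈ Submodule.span k (Set.range x)) :
    Finite T ∧ Nat.card T ≤ d ^ Fintype.card ι := by
  classical
  set S := Algebra.adjoin k (Set.range x)
  have : Module.Finite k S := Module.Finite.iff_fg.2 (fg_adjoin_of_pow_mem hd hx)
  have hinj : Function.Injective fun P : T =>
      (Pi.evalAlgHom k (fun _ : T => k) P).comp S.val := fun P Q h => hsep P Q fun i =>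
    DFunLike.congr_fun h ⟨x i, Algebra.subset_adjoin (Set.mem_range_self i)⟩
  refine ⟨.of_injective _ hinj, ?_⟩
  calc Nat.card T ≤ Nat.card (S →ₐ[k] k) := Nat.card_le_card_of_injective _ hinj
    _ ≤ Module.finrank k (Subalgebra.toSubmodule S) := card_algHom_le_finrank k S k
    _ ≤ Fintype.card (ι → Fin d) := by
      rw [toSubmodule_adjoin_eq_span_of_pow_mem hd hx]
      exact finrank_range_le_card _
    _ = d ^ Fintype.card ι := by simp

end PowersInSpan

/-- The Hénon map `(x, y) ↦ (y, x + y - y³)` over which `f` is fibred, on the points of the plane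
with values in `A`. -/
def henon {A : Type*} [CommRing A] (u : A × A) : A × A := (u.2, u.1 + u.2 - u.2 ^ 3)

section Henon

variable {A : Type*} [CommRing A]

lemma map_henon_iterate {B : Type*} [CommRing B] (φ : A →+* B) (u : A × A) (n : ℕ) :
    Prod.map φ φ (henon^[n] u) = henon^[n] (Prod.map φ φ u) :=
  Function.Semiconj.iterate_right (f := Prod.map φ φ) (fun u => by simp [henon]) n u

/-- The contribution of an orbit of the Hénon map to the last coordinate: that of `fⁿ (x, y, z)` is
`2 ^ n * z - orbitSum n (x, y)`. -/
def orbitSum (n : ℕ) (u : A × A) : A :=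
  ∑ k ∈ Finset.range n, 2 ^ (n - 1 - k) * (henon^[k] u).2

lemma orbitSum_succ (n : ℕ) (u : A × A) :
    orbitSum (n + 1) u = 2 * orbitSum n u + (henon^[n] u).2 := by
  rw [orbitSum, Finset.sum_range_succ, orbitSum, Finset.mul_sum, Nat.add_sub_cancel, Nat.sub_self,
    pow_zero, one_mul]
  refine congrArg (· + _) (Finset.sum_congr rfl fun k hk => ?_)
  have := Finset.mem_range.1 hk
  rw [show n - k = (n - 1 - k) + 1 by omega, pow_succ', mul_assoc]

lemma map_orbitSum {B : Type*} [CommRing B] (φ : A →+* B) (n : ℕ) (u : A × A) :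
    φ (orbitSum n u) = orbitSum n (Prod.map φ φ u) := by
  simp only [orbitSum, map_sum, map_mul, map_pow, map_ofNat, ← map_henon_iterate, Prod.map_snd]

lemma fst_henon_iterate_succ (u : A × A) (n : ℕ) : (henon^[n + 1] u).1 = (henon^[n] u).2 := by
  rw [Function.iterate_succ_apply']
  rfl

lemma fst_henon_iterate_succ_pow_three (u : A × A) (n : ℕ) :
    (henon^[n + 1] u).1 ^ 3 =
      (henon^[n] u).1 + (henon^[n + 1] u).1 - (henon^[n + 2] u).1 := by
  rw [fst_henon_iterate_succ u (n + 1), fst_henon_iterate_succ u n, Function.iterate_succ_apply']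
  simp [henon]

lemma henon_iterate_mod {u : A × A} {n : ℕ} (hu : henon^[n] u = u) (i : ℕ) :
    henon^[i % n] u = henon^[i] u :=
  Function.IsPeriodicPt.iterate_mod_apply hu i

lemma pow_three_mem_span_of_isPeriodic (R : Type*) [CommRing R] [Algebra R A] {u : A × A} {n : ℕ}
    (hn : 0 < n) (hu : henon^[n] u = u) (i : Fin n) :
    (henon^[i] u).1 ^ 3 ∈
      Submodule.span R (Set.range fun j : Fin n => (henon^[j] u).1) := by
  have hmem (j : ℕ) : (henon^[j] u).1 ∈
      Submodule.span R (Set.range fun j : Fin n => (henon^[j] u).1) :=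
    Submodule.subset_span ⟨⟨j % n, Nat.mod_lt j hn⟩, congrArg Prod.fst (henon_iterate_mod hu j)⟩
  have hshift : henon^[i] u = henon^[i + (n - 1) + 1] u := by
    rw [← henon_iterate_mod hu (i + (n - 1) + 1), show (i : ℕ) + (n - 1) + 1 = i + n by omega,
      Nat.add_mod_right, Nat.mod_eq_of_lt i.2]
  rw [hshift, fst_henon_iterate_succ_pow_three]
  exact sub_mem (add_mem (hmem _) (hmem _)) (hmem _)

lemma isIntegral_of_isPeriodic (R : Type*) [CommRing R] [Algebra R A] {u : A × A} {n : ℕ}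
    (hn : 0 < n) (hu : henon^[n] u = u) : IsIntegral R u.1 ∧ IsIntegral R u.2 := by
  have h (j : ℕ) : IsIntegral R (henon^[j] u).1 := by
    rw [← henon_iterate_mod hu]
    exact isIntegral_of_pow_mem (by norm_num) (pow_three_mem_span_of_isPeriodic R hn hu)
      ⟨j % n, Nat.mod_lt j hn⟩
  exact ⟨h 0, h 1⟩

lemma onPoints_f (P : Fin 3 → Qbar) :
    onPoints f P = ![P 1, P 0 + P 1 - P 1 ^ 3, 2 * P 2 - P 1] :=
  funext fun i => aeval_f_apply P i

lemma onPoints_f_iterate (P : Fin 3 → Qbar) (n : ℕ) :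
    (onPoints f)^[n] P = ![(henon^[n] (P 0, P 1)).1, (henon^[n] (P 0, P 1)).2,
      2 ^ n * P 2 - orbitSum n (P 0, P 1)] := by
  induction n with
  | zero =>
    ext i
    fin_cases i <;> simp [orbitSum]
  | succ n ih =>
    rw [Function.iterate_succ_apply', ih, onPoints_f, Function.iterate_succ_apply', orbitSum_succ,
      henon]
    congr 3
    simp
    ring

lemma mem_Per_iff {n : ℕ} (P : Fin 3 → Qbar) :
    P ∈ Per n (onPoints f) ↔ henon^[n] (P 0, P 1) = (P 0, P 1) ∧
      (2 ^ n - 1) * P 2 = orbitSum n (P 0, P 1) := by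
  rw [Per, Set.mem_ofPred_eq, onPoints_f_iterate, funext_iff, Fin.forall_fin_succ,
    Fin.forall_fin_two, Prod.ext_iff, and_assoc]
  refine and_congr_right' (and_congr_right' ?_)
  change _ = P 2 ↔ _
  simp only [Fin.succ_one_eq_two, Matrix.cons_val]
  rw [sub_one_mul, sub_eq_iff_eq_add, sub_eq_iff_eq_add']

lemma two_pow_sub_one_ne_zero {n : ℕ} (hn : n ≠ 0) : (2 : Qbar) ^ n - 1 ≠ 0 := by
  rw [sub_ne_zero]
  exact_mod_cast (Nat.one_lt_two_pow hn).ne'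

lemma eq_of_mem_Per {n : ℕ} (hn : n ≠ 0) {P Q : Fin 3 → Qbar} (hP : P ∈ Per n (onPoints f))
    (hQ : Q ∈ Per n (onPoints f)) (h0 : P 0 = Q 0) (h1 : P 1 = Q 1) : P = Q := by
  have h2 : P 2 = Q 2 := by
    refine mul_left_cancel₀ (two_pow_sub_one_ne_zero hn) ?_
    rw [((mem_Per_iff P).1 hP).2, ((mem_Per_iff Q).1 hQ).2, h0, h1]
  exact funext (Fin.forall_fin_succ.2 ⟨h0, Fin.forall_fin_two.2 ⟨h1, h2⟩⟩)

lemma finite_and_card_Per_le {n : ℕ} (hn : 1 ≤ n) :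
    Finite (Per n (onPoints f)) ∧ Nat.card (Per n (onPoints f)) ≤ 3 ^ n := by
  -- the points of `Per n` assemble to a single periodic point over the ring of functions on it
  set u : (Per n (onPoints f) → Qbar) × (Per n (onPoints f) → Qbar) :=
    (fun P => P.1 0, fun P => P.1 1)
  have hval (P : Per n (onPoints f)) (i : ℕ) : ((henon^[i] u).1 P, (henon^[i] u).2 P) =
      henon^[i] (P.1 0, P.1 1) :=
    map_henon_iterate (Pi.evalRingHom (fun _ => Qbar) P) u i
  have hu : henon^[n] u = u := by
    have h (P : Per n (onPoints f)) := (hval P n).trans ((mem_Per_iff P.1).1 P.2).1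
    exact Prod.ext (funext fun P => congrArg Prod.fst (h P))
      (funext fun P => congrArg Prod.snd (h P))
  have hsep (P Q : Per n (onPoints f)) (h : ∀ j : Fin n, (henon^[j] u).1 P = (henon^[j] u).1 Q) :
      P = Q := by
    have hall (i : ℕ) : (henon^[i] u).1 P = (henon^[i] u).1 Q := by
      rw [← henon_iterate_mod hu]
      exact h ⟨i % n, Nat.mod_lt i hn⟩
    exact Subtype.ext (eq_of_mem_Per (Nat.one_le_iff_ne_zero.1 hn) P.2 Q.2 (hall 0) (hall 1))
  simpa using finite_and_card_le_of_pow_mem (by norm_num) hsep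
    (pow_three_mem_span_of_isPeriodic Qbar hn hu)

lemma finite_Per {n : ℕ} (hn : 1 ≤ n) : (Per n (onPoints f)).Finite :=
  Set.finite_coe_iff.1 (finite_and_card_Per_le hn).1

lemma ncard_Per_le {n : ℕ} (hn : 1 ≤ n) : (Per n (onPoints f)).ncard ≤ 3 ^ n :=
  (finite_and_card_Per_le hn).2

end Henon

section CharThree

lemma geom_sum_eq_sub_one_pow {R : Type*} [Ring R] (p : ℕ) [Fact p.Prime] [CharP R p] (y : R)
    (m : ℕ) : ∑ i ∈ Finset.range (p ^ m), y ^ i = (y - 1) ^ (p ^ m - 1) := by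
  -- `R` has zero divisors, so divide by `X - 1` in the polynomial ring
  have hX : ∑ i ∈ Finset.range (p ^ m), (Polynomial.X : Polynomial (ZMod p)) ^ i =
      (Polynomial.X - 1) ^ (p ^ m - 1) := by
    refine mul_right_cancel₀ (Polynomial.X_sub_C_ne_zero (1 : ZMod p)) ?_
    rw [map_one, geom_sum_mul, ← pow_succ,
      Nat.sub_add_cancel (Nat.one_le_pow _ _ (Fact.out : p.Prime).pos), sub_pow_char_pow, one_pow]
  let := ZMod.algebra R p
  simpa using congrArg (Polynomial.aeval y) hX

variable {R : Type*} [Ring R] [CharP R 3] {M τ : R}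

lemma pow_two_mul_three_pow (hc : Commute M τ) (hM : M * M = 1 + (1 - τ) * M) (m : ℕ) :
    M ^ (2 * 3 ^ m) = 1 + (1 - τ ^ 3 ^ m) * M ^ 3 ^ m := by
  have hc1 : Commute (1 - τ) M := (Commute.one_left M).sub_left hc.symm
  rw [pow_mul, pow_two, hM, add_pow_char_pow_of_commute 3 m (Commute.one_left _), one_pow,
    hc1.mul_pow, sub_pow_char_pow_of_commute 3 m (Commute.one_left τ), one_pow]

lemma sum_range_two_mul_neg_pow {S : Type*} [Ring S] (M : S) (n : ℕ) :
    ∑ k ∈ Finset.range (2 * n), (-M) ^ k = (1 - M) * ∑ j ∈ Finset.range n, (M * M) ^ j := by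
  induction n with
  | zero => simp
  | succ n ih =>
    rw [mul_add_one, Finset.sum_range_succ, Finset.sum_range_succ, ih, Finset.sum_range_succ,
      mul_add, add_assoc, ← pow_two, ← pow_mul, pow_succ' (-M), (even_two_mul n).neg_pow]
    noncomm_ring

lemma sum_neg_pow_two_mul_three_pow (hc : Commute M τ) (hM : M * M = 1 + (1 - τ) * M) (m : ℕ) :
    ∑ k ∈ Finset.range (2 * 3 ^ m), (-M) ^ k =
      (1 - M) * (M ^ (3 ^ m - 1) * ∑ i ∈ Finset.range (3 ^ m), τ ^ i) := by
  have hc1 : Commute M (1 - τ) := (Commute.one_right M).sub_right hc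
  have heven : Even (3 ^ m - 1) := Nat.Odd.sub_odd (Odd.pow (by decide)) odd_one
  rw [sum_range_two_mul_neg_pow, geom_sum_eq_sub_one_pow 3, geom_sum_eq_sub_one_pow 3, hM,
    add_sub_cancel_left, ← neg_sub 1 τ, heven.neg_pow, ← hc1.mul_pow, hc1.eq]

variable {κ : Type*} [Field κ] [CharP κ 3]

/-- The Frobenius map of the plane, as an element `τ` of the ring of additive endomorphisms. -/
def frobEnd (κ : Type*) [Field κ] [CharP κ 3] : Module.End ℤ (κ × κ) :=
  ((frobenius κ 3).toAddMonoidHom.prodMap (frobenius κ 3).toAddMonoidHom).toIntLinearMap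

/-- The Hénon map in characteristic three, where it is additive, as an element `M` of the ring of
additive endomorphisms of the plane. -/
def henonEnd (κ : Type*) [Field κ] [CharP κ 3] : Module.End ℤ (κ × κ) :=
  AddMonoidHom.toIntLinearMap <| AddMonoidHom.mk' henon fun u v => by
    simp only [henon, Prod.snd_add, Prod.fst_add, add_pow_char, Prod.mk_add_mk, Prod.mk.injEq,
      true_and]
    ring

lemma frobEnd_apply (u : κ × κ) : frobEnd κ u = (u.1 ^ 3, u.2 ^ 3) := rfl

lemma henonEnd_apply (u : κ × κ) : henonEnd κ u = henon u := rfl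

instance charP_end : CharP (Module.End ℤ (κ × κ)) 3 := by
  rw [CharP.charP_iff_prime_eq_zero Nat.prime_three]
  have h (a : κ) : 3 • a = 0 := by rw [nsmul_eq_mul, CharP.cast_eq_zero κ 3, zero_mul]
  exact LinearMap.ext fun u => Prod.ext (h u.1) (h u.2)

lemma commute_henonEnd_frobEnd : Commute (henonEnd κ) (frobEnd κ) :=
  LinearMap.ext fun u => by
    simp only [Module.End.mul_apply, frobEnd_apply, henonEnd_apply, henon, sub_pow_char,
      add_pow_char]

lemma henonEnd_mul_self : henonEnd κ * henonEnd κ = 1 + (1 - frobEnd κ) * henonEnd κ := by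
  refine LinearMap.ext fun u => ?_
  change henon (henon u) = u + (henon u - frobEnd κ (henon u))
  refine Prod.ext ?_ ?_ <;>
    simp only [frobEnd_apply, henon, Prod.fst_add, Prod.snd_add, Prod.fst_sub, Prod.snd_sub]
  · ring
  · ring

lemma frobEnd_pow_apply (u : κ × κ) (i : ℕ) :
    (frobEnd κ ^ i) u = (u.1 ^ 3 ^ i, u.2 ^ 3 ^ i) := by
  induction i with
  | zero => simp
  | succ i ih =>
    rw [pow_succ', Module.End.mul_apply, ih, frobEnd_apply]
    simp only [← pow_mul, ← pow_succ]

lemma henonEnd_pow_apply (u : κ × κ) (i : ℕ) : (henonEnd κ ^ i) u = henon^[i] u :=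
  Module.End.pow_apply _ i u

lemma henon_iterate_eq_self {m : ℕ} {u : κ × κ} (h1 : u.1 ^ 3 ^ 3 ^ m = u.1)
    (h2 : u.2 ^ 3 ^ 3 ^ m = u.2) : henon^[2 * 3 ^ m] u = u := by
  have hc : Commute (1 - frobEnd κ ^ 3 ^ m) (henonEnd κ ^ 3 ^ m) :=
    ((Commute.one_left _).sub_left ((commute_henonEnd_frobEnd.symm).pow_left _)).pow_right _
  rw [← henonEnd_pow_apply, pow_two_mul_three_pow commute_henonEnd_frobEnd henonEnd_mul_self,
    hc.eq, LinearMap.add_apply, Module.End.mul_apply, LinearMap.sub_apply,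
    Module.End.one_apply, frobEnd_pow_apply, h1, h2, Prod.mk.eta, sub_self, map_zero, add_zero]

/-- The trace from the field with `3 ^ 3 ^ m` elements to the prime field, as a polynomial
expression that makes sense in any ring. -/
def trThree {A : Type*} [CommRing A] (m : ℕ) (a : A) : A := ∑ i ∈ Finset.range (3 ^ m), a ^ 3 ^ i

lemma map_trThree {A B : Type*} [CommRing A] [CommRing B] (φ : A →+* B) (m : ℕ) (a : A) :
    φ (trThree m a) = trThree m (φ a) := by
  simp only [trThree, map_sum, map_pow]

lemma trThree_pow_three {m : ℕ} {a : κ} (h : a ^ 3 ^ 3 ^ m = a) :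
    trThree m a ^ 3 = trThree m a := by
  have hshift : ∑ i ∈ Finset.range (3 ^ m), a ^ 3 ^ (i + 1) + a =
      ∑ i ∈ Finset.range (3 ^ m), a ^ 3 ^ i + a := by
    have h0 := Finset.sum_range_succ' (fun i => a ^ 3 ^ i) (3 ^ m)
    rwa [Finset.sum_range_succ, h, pow_zero, pow_one, eq_comm] at h0
  simpa only [trThree, sum_pow_char 3, ← pow_mul, ← pow_succ] using add_right_cancel hshift

lemma sum_frobEnd_pow_apply (m : ℕ) (u : κ × κ) :
    (∑ i ∈ Finset.range (3 ^ m), frobEnd κ ^ i) u = (trThree m u.1, trThree m u.2) := by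
  simp only [LinearMap.sum_apply, frobEnd_pow_apply, trThree]
  exact Prod.ext Prod.fst_sum Prod.snd_sum

lemma henon_eq_swap {A : Type*} [CommRing A] {c d : A} (hd : d ^ 3 = d) :
    henon (c, d) = (d, c) := by
  simp [henon, hd]

lemma henon_iterate_of_even {A : Type*} [CommRing A] {c d : A} (hc : c ^ 3 = c) (hd : d ^ 3 = d)
    {j : ℕ} (hj : Even j) : henon^[j] (c, d) = (c, d) := by
  obtain ⟨r, rfl⟩ := even_iff_two_dvd.1 hj
  rw [Function.iterate_mul]
  refine Function.iterate_fixed ?_ r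
  change henon (henon (c, d)) = _
  rw [henon_eq_swap hd, henon_eq_swap hc]

lemma sum_neg_henonEnd_pow_apply {m : ℕ} {u : κ × κ} (h1 : u.1 ^ 3 ^ 3 ^ m = u.1)
    (h2 : u.2 ^ 3 ^ 3 ^ m = u.2) :
    (∑ k ∈ Finset.range (2 * 3 ^ m), (-henonEnd κ) ^ k) u =
      (trThree m u.1 - trThree m u.2, trThree m u.2 - trThree m u.1) := by
  have hd := trThree_pow_three h2
  rw [sum_neg_pow_two_mul_three_pow commute_henonEnd_frobEnd henonEnd_mul_self,
    Module.End.mul_apply, Module.End.mul_apply, sum_frobEnd_pow_apply, henonEnd_pow_apply,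
    henon_iterate_of_even (trThree_pow_three h1) hd
      (Nat.Odd.sub_odd (Odd.pow (by decide)) odd_one),
    LinearMap.sub_apply, henonEnd_apply, henon_eq_swap hd]
  rfl

lemma orbitSum_two_mul_three_pow {m : ℕ} {u : κ × κ} (h1 : u.1 ^ 3 ^ 3 ^ m = u.1)
    (h2 : u.2 ^ 3 ^ 3 ^ m = u.2) :
    orbitSum (2 * 3 ^ m) u = trThree m u.1 - trThree m u.2 := by
  have htwo : (2 : κ) = -1 := by linear_combination CharP.cast_eq_zero κ 3
  have hterm (k : ℕ) (hk : k < 2 * 3 ^ m) :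
      (2 : κ) ^ (2 * 3 ^ m - 1 - k) * (henon^[k] u).2 = -(((-henonEnd κ) ^ k) u).2 := by
    have hsign : (-1 : κ) ^ (2 * 3 ^ m - 1 - k) = -(-1) ^ k := by
      have hodd : Odd ((2 * 3 ^ m - 1 - k) + k) := by
        rw [Nat.sub_add_cancel (by omega)]
        exact Nat.Even.sub_odd (by omega) (even_two_mul _) odd_one
      rw [← mul_right_inj' (pow_ne_zero k (neg_ne_zero.2 one_ne_zero)), ← pow_add, add_comm,
        hodd.neg_one_pow, mul_neg, ← mul_pow, neg_mul_neg, one_mul, one_pow]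
    rw [htwo, hsign]
    rcases Nat.even_or_odd k with hk | hk
    · rw [hk.neg_one_pow, hk.neg_pow, henonEnd_pow_apply, neg_one_mul]
    · rw [hk.neg_one_pow, hk.neg_pow, LinearMap.neg_apply, henonEnd_pow_apply, neg_neg, one_mul,
        Prod.snd_neg, neg_neg]
  have hsum := congrArg Prod.snd (sum_neg_henonEnd_pow_apply h1 h2)
  rw [LinearMap.sum_apply, Prod.snd_sum] at hsum
  rw [orbitSum, Finset.sum_congr rfl fun k hk => hterm k (Finset.mem_range.1 hk),
    Finset.sum_neg_distrib, hsum, neg_sub]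

end CharThree

section Ultrametric

lemma norm_sub_le_max_norm {E : Type*} [SeminormedAddCommGroup E] [IsUltrametricDist E] (u v : E) :
    ‖u - v‖ ≤ max ‖u‖ ‖v‖ := by
  simpa [sub_eq_add_neg] using IsUltrametricDist.norm_add_le_max u (-v)

instance isUltrametricDist_prod {X Y : Type*} [PseudoMetricSpace X] [PseudoMetricSpace Y]
    [IsUltrametricDist X] [IsUltrametricDist Y] : IsUltrametricDist (X × Y) where
  dist_triangle_max x y z := max_le
    ((dist_triangle_max x.1 y.1 z.1).trans (max_le_max (le_max_left _ _) (le_max_left _ _)))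
    ((dist_triangle_max x.2 y.2 z.2).trans (max_le_max (le_max_right _ _) (le_max_right _ _)))

-- Newton's method with the fixed slope `L`: the map `u ↦ u - L⁻¹ (G u)` contracts the ball.
lemma exists_eq_zero_of_approx {E : Type*} [NormedAddCommGroup E] [IsUltrametricDist E]
    [CompleteSpace E] {G : E → E} {L : E →+ E} {u₀ : E} {θ : ℝ} (hθ0 : 0 ≤ θ) (hθ1 : θ < 1)
    (hLsurj : Function.Surjective L) (hL : ∀ v, ‖L v‖ = ‖v‖)
    (hG : ∀ u ∈ Metric.closedBall u₀ ‖G u₀‖, ∀ v ∈ Metric.closedBall u₀ ‖G u₀‖,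
      ‖G u - G v - L (u - v)‖ ≤ θ * ‖u - v‖) :
    ∃ u, ‖u - u₀‖ ≤ ‖G u₀‖ ∧ G u = 0 := by
  choose B hB using hLsurj
  set Φ : E → E := fun u => u - B (G u)
  have hstep (u : E) : ‖Φ u - u‖ = ‖G u‖ := by
    rw [sub_sub_cancel_left, norm_neg, ← hL, hB]
  have hcontr : ∀ u ∈ Metric.closedBall u₀ ‖G u₀‖, ∀ v ∈ Metric.closedBall u₀ ‖G u₀‖,
      ‖Φ u - Φ v‖ ≤ θ * ‖u - v‖ := fun u hu v hv => by
    have hLΦ : L (Φ u - Φ v) = -(G u - G v - L (u - v)) := by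
      simp only [Φ, map_sub, hB]
      abel
    rw [← hL, hLΦ, norm_neg]
    exact hG u hu v hv
  have hmaps : Set.MapsTo Φ (Metric.closedBall u₀ ‖G u₀‖) (Metric.closedBall u₀ ‖G u₀‖) := by
    intro u hu
    have hu₀ := hcontr u hu u₀ (Metric.mem_closedBall_self (norm_nonneg _))
    rw [mem_closedBall_iff_norm] at hu ⊢
    rw [← sub_add_sub_cancel (Φ u) (Φ u₀) u₀]
    exact (IsUltrametricDist.norm_add_le_max _ _).trans (max_le
      (hu₀.trans ((mul_le_of_le_one_left (norm_nonneg _) hθ1.le).trans hu)) (hstep u₀).le)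
  have hcw : ContractingWith ⟨θ, hθ0⟩ (hmaps.restrict Φ _ _) :=
    ⟨hθ1, LipschitzWith.of_dist_le_mul fun v w => by
      rw [Subtype.dist_eq, Subtype.dist_eq, Set.MapsTo.val_restrict_apply,
        Set.MapsTo.val_restrict_apply, dist_eq_norm, dist_eq_norm]
      exact hcontr v.1 v.2 w.1 w.2⟩
  obtain ⟨u, hu, hfix, -⟩ := hcw.exists_fixedPoint' Metric.isClosed_closedBall.isComplete hmaps
    (Metric.mem_closedBall_self (norm_nonneg _)) (edist_ne_top u₀ _)
  refine ⟨u, mem_closedBall_iff_norm.1 hu, ?_⟩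
  rw [← norm_eq_zero, ← hstep, hfix.eq, sub_self, norm_zero]

end Ultrametric

section Lifting

/-- The linear part `(x, y) ↦ (y, x + y)` of the Hénon map. -/
def fibEnd (A : Type*) [CommRing A] : Module.End A (A × A) :=
  (LinearMap.snd A A A).prod (LinearMap.fst A A A + LinearMap.snd A A A)

lemma fibEnd_apply {A : Type*} [CommRing A] (u : A × A) : fibEnd A u = (u.2, u.1 + u.2) := rfl

lemma fibEnd_sq (A : Type*) [CommRing A] : fibEnd A ^ 2 = fibEnd A + 1 := by
  refine LinearMap.ext fun u => ?_
  change fibEnd A (fibEnd A u) = fibEnd A u + u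
  simp only [fibEnd_apply, Prod.add_def, add_comm]

lemma surjective_fibEnd (A : Type*) [CommRing A] : Function.Surjective (fibEnd A) := fun u =>
  ⟨(u.2 - u.1, u.1), by simp [fibEnd_apply]⟩

-- Lucas numbers: they are congruent to `1` modulo `3` at the exponents `3 ^ m`.
lemma exists_fib_dvd_pow_sub {R : Type*} [CommRing R] (x : R) (m : ℕ) :
    ∃ k : ℤ, x ^ 2 - x - 1 ∣ (x ^ 3 ^ m) ^ 2 - (3 * k + 1) * x ^ 3 ^ m - 1 := by
  induction m with
  | zero => exact ⟨0, by simp⟩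
  | succ m ih =>
    obtain ⟨k, hk⟩ := ih
    set y := x ^ 3 ^ m
    refine ⟨9 * k ^ 3 + 9 * k ^ 2 + 6 * k + 1, hk.trans
      ⟨y ^ 4 + (3 * k + 1) * y ^ 3 + ((3 * k + 1) ^ 2 + 1) * y ^ 2 - (3 * k + 1) * y + 1, ?_⟩⟩
    rw [show x ^ 3 ^ (m + 1) = y ^ 3 by rw [pow_succ, pow_mul]]
    push_cast
    ring

lemma exists_fibEnd_pow_eq (A : Type*) [CommRing A] (m : ℕ) :
    ∃ k : ℤ, fibEnd A ^ (2 * 3 ^ m) = ((3 * k + 1 : ℤ) : A) • fibEnd A ^ 3 ^ m + 1 := by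
  obtain ⟨k, hk⟩ := exists_fib_dvd_pow_sub (Polynomial.X : Polynomial A) m
  refine ⟨k, ?_⟩
  have h0 := map_dvd (Polynomial.aeval (fibEnd A)) hk
  simp only [map_sub, map_mul, map_add, map_one, map_pow, Polynomial.aeval_X, fibEnd_sq,
    add_sub_cancel_left, sub_self, zero_dvd_iff, map_intCast, map_ofNat] at h0
  rw [sub_eq_zero, sub_eq_iff_eq_add, ← pow_mul, mul_comm] at h0
  rw [h0, add_comm, Algebra.smul_def, map_intCast]
  push_cast
  rfl

variable {C : Type*} [NormedField C] [IsUltrametricDist C]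

lemma norm_fibEnd_apply (u : C × C) : ‖fibEnd C u‖ = ‖u‖ := by
  rw [fibEnd_apply, Prod.norm_mk]
  refine le_antisymm (max_le (norm_snd_le u) (IsUltrametricDist.norm_add_le_max _ _))
    (max_le ?_ (le_max_left _ _))
  have h := norm_sub_le_max_norm (u.1 + u.2) u.2
  rwa [add_sub_cancel_right, max_comm] at h

lemma norm_fibEnd_pow_apply (k : ℕ) (u : C × C) : ‖(fibEnd C ^ k) u‖ = ‖u‖ := by
  induction k with
  | zero => rfl
  | succ k ih => rw [pow_succ', Module.End.mul_apply, norm_fibEnd_apply, ih]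

lemma norm_three_mul_add_one (h3 : ‖(3 : C)‖ < 1) (k : ℤ) : ‖((3 * k + 1 : ℤ) : C)‖ = 1 := by
  have hlt : ‖(3 * k : C)‖ < ‖(1 : C)‖ := by
    rw [norm_mul, norm_one]
    exact (mul_le_of_le_one_right (norm_nonneg _)
      (IsUltrametricDist.norm_intCast_le_one C k)).trans_lt h3
  push_cast
  rw [IsUltrametricDist.norm_add_eq_max_of_norm_ne_norm hlt.ne, max_eq_right hlt.le, norm_one]

lemma fibEnd_pow_sub_one_isometric (h3 : ‖(3 : C)‖ < 1) (m : ℕ) :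
    Function.Surjective (fibEnd C ^ (2 * 3 ^ m) - 1 : Module.End C (C × C)) ∧
      ∀ v, ‖(fibEnd C ^ (2 * 3 ^ m) - 1 : Module.End C (C × C)) v‖ = ‖v‖ := by
  obtain ⟨k, hk⟩ := exists_fibEnd_pow_eq C m
  have hc := norm_three_mul_add_one h3 k
  rw [hk, add_sub_cancel_right]
  refine ⟨fun v => ?_, fun v => ?_⟩
  · obtain ⟨w, hw⟩ := ((surjective_fibEnd C).iterate (3 ^ m)) (((3 * k + 1 : ℤ) : C)⁻¹ • v)
    exact ⟨w, by rw [LinearMap.smul_apply, Module.End.pow_apply, hw,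
      smul_inv_smul₀ (norm_ne_zero_iff.1 (hc ▸ one_ne_zero))]⟩
  · rw [LinearMap.smul_apply, norm_smul, hc, one_mul, norm_fibEnd_pow_apply]

lemma norm_henon_le {u : C × C} (hu : ‖u‖ ≤ 1) : ‖henon u‖ ≤ 1 := by
  have h1 := (norm_fst_le u).trans hu
  have h2 := (norm_snd_le u).trans hu
  refine max_le h2 ((norm_sub_le_max_norm _ _).trans (max_le
    ((IsUltrametricDist.norm_add_le_max _ _).trans (max_le h1 h2)) ?_))
  rw [norm_pow]
  exact pow_le_one₀ (norm_nonneg _) h2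

lemma norm_henon_iterate_le {u : C × C} (hu : ‖u‖ ≤ 1) (k : ℕ) : ‖henon^[k] u‖ ≤ 1 := by
  induction k with
  | zero => exact hu
  | succ k ih =>
    rw [Function.iterate_succ_apply']
    exact norm_henon_le ih

lemma norm_henon_sub_sub_fibEnd_le {θ : ℝ} (h3 : ‖(3 : C)‖ ≤ θ) (hθ : θ ≤ 1) {u v : C × C}
    (hu : ‖u‖ ≤ 1) (hv : ‖v‖ ≤ 1) (huv : ‖u - v‖ ≤ θ) :
    ‖henon u - henon v - fibEnd C (u - v)‖ ≤ θ * ‖u - v‖ := by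
  have hu2 := (norm_snd_le u).trans hu
  have hv2 := (norm_snd_le v).trans hv
  have hd := norm_snd_le (u - v)
  have hθ0 : 0 ≤ θ := (norm_nonneg _).trans h3
  have heq : henon u - henon v - fibEnd C (u - v) =
      (0, -((3 * (u.2 * v.2) + (u - v).2 ^ 2) * (u - v).2)) := by
    refine Prod.ext ?_ ?_ <;>
      simp only [henon, fibEnd_apply, Prod.fst_sub, Prod.snd_sub] <;> ring
  rw [heq, Prod.norm_mk, norm_zero, norm_neg, norm_mul]
  refine max_le (by positivity) (mul_le_mul ?_ hd (norm_nonneg _) hθ0)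
  refine (IsUltrametricDist.norm_add_le_max _ _).trans (max_le ?_ ?_)
  · rw [norm_mul, norm_mul]
    exact (mul_le_of_le_one_right (norm_nonneg _) (mul_le_one₀ hu2 (norm_nonneg _) hv2)).trans h3
  · rw [norm_pow, pow_two]
    exact (mul_le_of_le_one_left (norm_nonneg _) (hd.trans (huv.trans hθ))).trans (hd.trans huv)

lemma norm_henon_iterate_sub_sub_fibEnd_pow_le {θ : ℝ} (h3 : ‖(3 : C)‖ ≤ θ) (hθ : θ ≤ 1)
    {u v : C × C} (hu : ‖u‖ ≤ 1) (hv : ‖v‖ ≤ 1) (huv : ‖u - v‖ ≤ θ) (k : ℕ) :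
    ‖henon^[k] u - henon^[k] v - (fibEnd C ^ k) (u - v)‖ ≤ θ * ‖u - v‖ := by
  have hθ0 : 0 ≤ θ := (norm_nonneg _).trans h3
  induction k with
  | zero => simpa using by positivity
  | succ k ih =>
    set u' := henon^[k] u
    set v' := henon^[k] v
    have huv' : ‖u' - v'‖ ≤ ‖u - v‖ := by
      rw [← sub_add_cancel (u' - v') ((fibEnd C ^ k) (u - v))]
      exact (IsUltrametricDist.norm_add_le_max _ _).trans (max_le
        (ih.trans (mul_le_of_le_one_left (norm_nonneg _) hθ)) (norm_fibEnd_pow_apply _ _).le)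
    have hsplit : henon u' - henon v' - fibEnd C ((fibEnd C ^ k) (u - v)) =
        (henon u' - henon v' - fibEnd C (u' - v')) +
          fibEnd C (u' - v' - (fibEnd C ^ k) (u - v)) := by
      rw [map_sub _ (u' - v')]
      abel
    rw [Function.iterate_succ_apply', Function.iterate_succ_apply', pow_succ', Module.End.mul_apply,
      hsplit]
    refine (IsUltrametricDist.norm_add_le_max _ _).trans (max_le ?_ ?_)
    · exact (norm_henon_sub_sub_fibEnd_le h3 hθ (norm_henon_iterate_le hu k)
        (norm_henon_iterate_le hv k) (huv'.trans huv)).trans (by gcongr)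
    · rwa [norm_fibEnd_apply]

lemma exists_isPeriodic_near [CompleteSpace C] (h3 : ‖(3 : C)‖ < 1) (m : ℕ) {u₀ : C × C}
    (hu₀ : ‖u₀‖ ≤ 1) (hper : ‖henon^[2 * 3 ^ m] u₀ - u₀‖ < 1) :
    ∃ u : C × C, ‖u - u₀‖ < 1 ∧ henon^[2 * 3 ^ m] u = u := by
  obtain ⟨hsurj, hiso⟩ := fibEnd_pow_sub_one_isometric h3 m
  set n := 2 * 3 ^ m
  set G : C × C → C × C := fun u => henon^[n] u - u
  set θ := max ‖(3 : C)‖ ‖G u₀‖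
  have hθ1 : θ < 1 := max_lt h3 hper
  have hball {u : C × C} (hu : u ∈ Metric.closedBall u₀ ‖G u₀‖) : ‖u‖ ≤ 1 := by
    rw [← sub_add_cancel u u₀]
    exact (IsUltrametricDist.norm_add_le_max _ _).trans
      (max_le ((mem_closedBall_iff_norm.1 hu).trans hper.le) hu₀)
  have happrox : ∀ u ∈ Metric.closedBall u₀ ‖G u₀‖, ∀ v ∈ Metric.closedBall u₀ ‖G u₀‖,
      ‖G u - G v - (fibEnd C ^ n - 1) (u - v)‖ ≤ θ * ‖u - v‖ := fun u hu v hv => by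
    have huv : ‖u - v‖ ≤ ‖G u₀‖ := by
      rw [← sub_sub_sub_cancel_right u v u₀]
      exact (norm_sub_le_max_norm _ _).trans
        (max_le (mem_closedBall_iff_norm.1 hu) (mem_closedBall_iff_norm.1 hv))
    have hsplit : G u - G v - (fibEnd C ^ n - 1) (u - v) =
        henon^[n] u - henon^[n] v - (fibEnd C ^ n) (u - v) := by
      rw [LinearMap.sub_apply, Module.End.one_apply]
      change henon^[n] u - u - (henon^[n] v - v) - _ = _
      abel
    rw [hsplit]
    exact norm_henon_iterate_sub_sub_fibEnd_pow_le (le_max_left _ _) hθ1.le (hball hu) (hball hv)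
      (huv.trans (le_max_right _ _)) n
  obtain ⟨u, hu, hu0⟩ := exists_eq_zero_of_approx (L := (fibEnd C ^ n - 1).toAddMonoidHom)
    ((norm_nonneg _).trans (le_max_left _ _)) hθ1 hsurj hiso happrox
  exact ⟨u, hu.trans_lt hper, sub_eq_zero.1 hu0⟩

end Lifting

section Height

open Height NumberField

variable {K : Type*} [Field K] [NumberField K]

lemma natCast_le_mulHeight {z : K} {n : ℕ} (hn : n ≠ 0) {a : 𝓞 K} (ha : n * z = a)
    (hnorm : Ideal.absNorm (Ideal.span {(n : 𝓞 K), a}) = n ^ (Module.finrank ℚ K - 1)) :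
    (n : ℝ) ≤ mulHeight ![z, 1] := by
  have hfin : n ^ (totalWeight K - 1) *
      ∏ᶠ v : FinitePlace K, ⨆ i, v (![(a : K), n] i) = 1 := by
    have h := absNorm_mul_finprod_finitePlace_eq_one (show ![a, (n : 𝓞 K)] ≠ 0 by simp [hn])
    have hcoe (i : Fin 2) : (![a, n] i : K) = ![(a : K), n] i := by fin_cases i <;> rfl
    rw [Matrix.range_cons, Matrix.range_cons, Matrix.range_empty, Set.union_empty, Set.union_comm,
      Set.singleton_union, hnorm, ← totalWeight_eq_finrank] at h
    simpa [hcoe] using h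
  rw [← mulHeight₁_eq_mulHeight, ← mul_div_cancel_left₀ z (mod_cast hn : (n : K) ≠ 0), ha,
    mulHeight₁_div_eq_mulHeight, NumberField.mulHeight_eq (by simp [hn])]
  refine le_of_mul_le_mul_left ?_ (show (0 : ℝ) < n ^ (totalWeight K - 1) by positivity)
  rw [pow_sub_one_mul (totalWeight_pos K).ne', mul_left_comm, hfin, mul_one,
    totalWeight_eq_sum_mult, ← Finset.prod_pow_eq_pow_sum Finset.univ]
  gcongr
  exact Finite.le_ciSup_of_le 1 <| by simp

/-- The denominator ideal of an algebraic number `z`: the algebraic integers `x` such that `x z` is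
integral. -/
def denomIdeal (z : K) : Ideal (𝓞 K) where
  carrier := {x | IsIntegral ℤ (x * z)}
  zero_mem' := by simpa using isIntegral_zero
  add_mem' := fun {x y} hx hy => by simpa [add_mul] using IsIntegral.add hx hy
  smul_mem' := fun c {x} hx => by simpa [mul_assoc] using c.isIntegral_coe.mul hx

lemma span_pair_mul_denomIdeal {z : K} {n : ℕ} (hn : n ≠ 0) {a : 𝓞 K} (ha : n * z = a) :
    Ideal.span {(n : 𝓞 K), a} * denomIdeal z = Ideal.span {(n : 𝓞 K)} := by
  have hn' : (n : K) ≠ 0 := mod_cast hn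
  refine le_antisymm (Ideal.mul_le.2 fun x hx y hy => ?_) ?_
  · obtain ⟨r, s, rfl⟩ := Ideal.mem_span_pair.1 hx
    obtain ⟨w, hw⟩ : ∃ w : 𝓞 K, (w : K) = y * z := ⟨⟨_, hy⟩, rfl⟩
    refine Ideal.mem_span_singleton'.2 ⟨r * y + s * w, RingOfIntegers.ext ?_⟩
    simp only [map_add, map_mul, map_natCast, hw, ← ha]
    ring
  · obtain ⟨d, hd⟩ : Ideal.span {(n : 𝓞 K), a} ∣ Ideal.span {(n : 𝓞 K)} :=
      Ideal.dvd_iff_le.2 (Ideal.span_mono (by simp))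
    rw [hd]
    refine Ideal.mul_mono_right fun x hx => ?_
    have hax : a * x ∈ Ideal.span {(n : 𝓞 K)} :=
      hd ▸ Ideal.mul_mem_mul (Ideal.subset_span (by simp)) hx
    obtain ⟨y, hy⟩ := Ideal.mem_span_singleton'.1 hax
    have hxz : (x : K) * z = y := by
      have hy' := congrArg (algebraMap (𝓞 K) K) hy
      simp only [map_mul, map_natCast, ← ha] at hy'
      exact mul_left_cancel₀ hn' (by linear_combination -hy')
    exact (congrArg (IsIntegral ℤ) hxz).mpr y.isIntegral_coe

lemma absNorm_denomIdeal (z : K) :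
    Ideal.absNorm (denomIdeal z) ≠ 0 ∧ (Ideal.absNorm (denomIdeal z) : ℝ) ≤ mulHeight ![z, 1] := by
  obtain ⟨n, hn, a, ha, hnorm⟩ :=
    exists_nat_ne_zero_exists_integer_mul_eq_and_absNorm_span_eq_pow z
  have hnd : Ideal.absNorm (denomIdeal z) = n := by
    have h := congrArg Ideal.absNorm (span_pair_mul_denomIdeal hn ha)
    rw [map_mul, Ideal.absNorm_span_natCast, RingOfIntegers.rank, hnorm,
      ← pow_sub_one_mul (Module.finrank_pos (R := ℚ) (M := K)).ne'] at h
    exact mul_left_cancel₀ (pow_ne_zero _ hn) h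
  rw [hnd]
  exact ⟨hn, natCast_le_mulHeight hn ha hnorm⟩

lemma isIntegral_norm_mul_prod {z : K} {x : 𝓞 K} (hx : x ∈ denomIdeal z)
    (I : Finset (K →ₐ[ℚ] Qbar)) :
    IsIntegral ℤ (((Algebra.intNorm ℤ (𝓞 K) x : ℤ) : Qbar) * ∏ σ ∈ I, σ z) := by
  classical
  have hnorm : ((Algebra.intNorm ℤ (𝓞 K) x : ℤ) : Qbar) = ∏ σ : K →ₐ[ℚ] Qbar, σ x := by
    rw [← Algebra.norm_eq_prod_embeddings ℚ Qbar (x : K), ← Algebra.coe_norm_int,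
      Algebra.intNorm_eq_norm, map_intCast]
  rw [hnorm, ← Finset.prod_mul_prod_compl I, mul_right_comm, ← Finset.prod_mul_distrib]
  refine IsIntegral.mul (IsIntegral.prod _ fun σ _ => ?_) (IsIntegral.prod _ fun σ _ => ?_)
  · rw [← map_mul]
    exact IsIntegral.map (σ.restrictScalars ℤ) hx
  · exact x.isIntegral_coe.map (σ.restrictScalars ℤ)

lemma isIntegral_absNorm_denomIdeal_mul_prod (z : K) (I : Finset (K →ₐ[ℚ] Qbar)) :
    IsIntegral ℤ ((Ideal.absNorm (denomIdeal z) : Qbar) * ∏ σ ∈ I, σ z) := by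
  have hmem : (Ideal.absNorm (denomIdeal z) : ℤ) ∈
      Ideal.span (Algebra.intNorm ℤ (𝓞 K) '' (denomIdeal z : Set (𝓞 K))) := by
    have h := Ideal.mem_span_singleton_self (Ideal.absNorm (denomIdeal z) : ℤ)
    rwa [← Ideal.relNorm_int (𝓞 K)] at h
  have hspan : ∀ c ∈ Ideal.span (Algebra.intNorm ℤ (𝓞 K) '' (denomIdeal z : Set (𝓞 K))),
      IsIntegral ℤ ((c : Qbar) * ∏ σ ∈ I, σ z) := fun c hc => by
    induction hc using Submodule.span_induction with
    | mem c hc =>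
      obtain ⟨x, hx, rfl⟩ := hc
      exact isIntegral_norm_mul_prod hx I
    | zero => simpa using isIntegral_zero
    | add c e _ _ hc he => simpa [add_mul] using hc.add he
    | smul b c _ hc => simpa [mul_assoc] using isIntegral_algebraMap.mul hc
  simpa using hspan _ hmem

end Height

section ThreeAdic

/-- An embedding of the algebraic numbers into the field of `3`-adic complex numbers. -/
noncomputable def toC3 : Qbar →ₐ[ℚ] ℂ_[3] := IsAlgClosed.lift

lemma norm_le_one_of_isIntegral {C : Type*} [NormedField C] [IsUltrametricDist C] {x : C}
    (hx : IsIntegral ℤ x) : ‖x‖ ≤ 1 :=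
  (Valuation.valuationSubring.integers (NormedField.valuation (K := C))).mem_of_integral
    hx.tower_top

lemma norm_natCast_padicComplex (p : ℕ) [Fact p.Prime] (n : ℕ) : ‖(n : ℂ_[p])‖ = ‖(n : ℚ_[p])‖ := by
  rw [← map_natCast (algebraMap ℚ_[p] ℂ_[p]), norm_algebraMap']

lemma pow_le_of_norm_natCast_le {p : ℕ} [Fact p.Prime] {N e : ℕ} (hN : N ≠ 0)
    (h : (p : ℝ) ^ e * ‖(N : ℂ_[p])‖ ≤ 1) : p ^ e ≤ N := by
  have hp : (0 : ℝ) < p := mod_cast (Fact.out : p.Prime).pos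
  have hle : ‖((N : ℤ) : ℚ_[p])‖ ≤ (p : ℝ) ^ (-(e : ℤ)) := by
    rw [zpow_neg, zpow_natCast, Int.cast_natCast, ← norm_natCast_padicComplex, ← one_div,
      le_div_iff₀ (by positivity), mul_comm]
    exact h
  rw [Padic.norm_int_le_pow_iff_dvd] at hle
  exact Nat.le_of_dvd (Nat.pos_of_ne_zero hN) (by exact_mod_cast hle)

open Height

lemma mulHeight_le_mulHeight_vecCons {K : Type*} [Field K] [NumberField K] {N : ℕ} (v : Fin N → K)
    (i : Fin N) : mulHeight ![v i, 1] ≤ mulHeight (Matrix.vecCons 1 v) := by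
  have hcomp : ![v i, 1] = Matrix.vecCons 1 v ∘ ![i.succ, 0] := by
    ext j
    fin_cases j <;> simp
  rw [hcomp]
  exact mulHeight_comp_le _ _

lemma le_height_of_conjugates {N : ℕ} (P : Fin N → Qbar) (i : Fin N) (m : ℕ)
    (I : Finset (fieldOfDef P →ₐ[ℚ] Qbar)) (hI : ∀ σ ∈ I, 3 ^ m ≤ ‖toC3 (σ (coords P i))‖) :
    (I.card : ℝ) / Module.finrank ℚ (fieldOfDef P) * (m * Real.log 3) ≤ height P := by
  obtain ⟨hD, hDle⟩ := absNorm_denomIdeal (coords P i)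
  have hint := isIntegral_absNorm_denomIdeal_mul_prod (coords P i) I
  set D := Ideal.absNorm (denomIdeal (coords P i))
  have hnorm : (3 : ℝ) ^ (m * I.card) * ‖(D : ℂ_[3])‖ ≤ 1 := by
    refine le_trans ?_ (norm_le_one_of_isIntegral (map_isIntegral_int toC3.toRingHom hint))
    simp only [AlgHom.toRingHom_eq_coe, RingHom.coe_coe, map_mul, map_natCast, map_prod,
      norm_mul, norm_prod]
    rw [mul_comm, pow_mul]
    gcongr
    rw [← Finset.prod_const]
    exact Finset.prod_le_prod (fun _ _ => by positivity) hI
  have hlog : ((m * I.card : ℕ) : ℝ) * Real.log 3 ≤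
      logHeight (Matrix.vecCons (1 : fieldOfDef P) (coords P)) := by
    rw [logHeight_eq_log_mulHeight, ← Real.log_pow]
    refine Real.log_le_log (by positivity) (le_trans ?_
      (hDle.trans (mulHeight_le_mulHeight_vecCons _ i)))
    exact_mod_cast pow_le_of_norm_natCast_le hD hnorm
  rw [height, div_mul_eq_mul_div]
  gcongr
  push_cast at hlog
  linarith

end ThreeAdic

section Residue

/-- The valuation ring of an ultrametric normed field. -/
noncomputable abbrev normInt (C : Type*) [NormedField C] [IsUltrametricDist C] :
    ValuationSubring C :=
  (NormedField.valuation (K := C)).valuationSubring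

/-- The residue field of an ultrametric normed field. -/
abbrev ResField (C : Type*) [NormedField C] [IsUltrametricDist C] : Type _ :=
  IsLocalRing.ResidueField (normInt C)

instance isAlgClosed_residueField {K : Type*} [Field K] [IsAlgClosed K] (A : ValuationSubring K) :
    IsAlgClosed (IsLocalRing.ResidueField A) := by
  refine IsAlgClosed.of_exists_root _ fun p hp hirr => ?_
  obtain ⟨q, hq, hdeg, hmon⟩ := Polynomial.lifts_and_natDegree_eq_and_monic
    ((Polynomial.mem_lifts p).2 (Polynomial.map_surjective _ IsLocalRing.residue_surjective p)) hp
  have hqdeg : (q.map (algebraMap A K)).degree ≠ 0 := by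
    rw [hmon.degree_map]
    exact Polynomial.degree_ne_of_natDegree_ne (hdeg ▸ hirr.natDegree_pos.ne')
  obtain ⟨x, hx⟩ := IsAlgClosed.exists_root _ hqdeg
  obtain ⟨y, rfl⟩ := IsIntegrallyClosed.isIntegral_iff.1
    (⟨q, hmon, by rwa [Polynomial.IsRoot, Polynomial.eval_map] at hx⟩ : IsIntegral A x)
  have hy : q.eval y = 0 := by
    rw [Polynomial.IsRoot, Polynomial.eval_map_algebraMap, Polynomial.aeval_algebraMap_apply] at hx
    exact (map_eq_zero_iff _ (FaithfulSMul.algebraMap_injective A K)).1 (by simpa using hx)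
  exact ⟨IsLocalRing.residue A y, by rw [← hq, Polynomial.eval_map_apply, hy, map_zero]⟩

variable {C : Type*} [NormedField C] [IsUltrametricDist C]

lemma norm_coe_normInt_le_one (x : normInt C) : ‖(x : C)‖ ≤ 1 := x.2

lemma residue_eq_zero_iff {x : normInt C} :
    IsLocalRing.residue (normInt C) x = 0 ↔ ‖(x : C)‖ < 1 := by
  rw [IsLocalRing.residue_eq_zero_iff, IsLocalRing.mem_maximalIdeal, mem_nonunits_iff,
    (Valuation.valuationSubring.integers _).isUnit_iff_valuation_eq_one]
  exact (show NormedField.valuation (x : C) ≤ 1 from x.2).lt_iff_ne.symm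

lemma residue_eq_residue_iff {x y : normInt C} :
    IsLocalRing.residue (normInt C) x = IsLocalRing.residue (normInt C) y ↔
      ‖(x : C) - y‖ < 1 := by
  rw [← sub_eq_zero, ← map_sub, residue_eq_zero_iff]
  rfl

lemma norm_natCast_lt_one (p : ℕ) [CharP (ResField C) p] : ‖(p : C)‖ < 1 := by
  have h := residue_eq_zero_iff (C := C) (x := p)
  rw [map_natCast, CharP.cast_eq_zero] at h
  exact h.1 rfl

instance charP_resField_padicComplex (p : ℕ) [hp : Fact p.Prime] : CharP (ResField ℂ_[p]) p := by
  rw [CharP.charP_iff_prime_eq_zero hp.out, ← map_natCast (IsLocalRing.residue (normInt ℂ_[p])),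
    residue_eq_zero_iff]
  change ‖(p : ℂ_[p])‖ < 1
  rw [norm_natCast_padicComplex]
  exact Padic.norm_p_lt_one

lemma exists_isPeriodic_residue_eq [CompleteSpace C] [CharP (ResField C) 3] (m : ℕ)
    {a b : ResField C} (ha : a ^ 3 ^ 3 ^ m = a) (hb : b ^ 3 ^ 3 ^ m = b) :
    ∃ u : normInt C × normInt C, henon^[2 * 3 ^ m] u = u ∧
      Prod.map (IsLocalRing.residue _) (IsLocalRing.residue _) u = (a, b) := by
  obtain ⟨x, rfl⟩ := IsLocalRing.residue_surjective a
  obtain ⟨y, rfl⟩ := IsLocalRing.residue_surjective b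
  set ι := (normInt C).subtype
  have hnear : ‖henon^[2 * 3 ^ m] ((x : C), (y : C)) - ((x : C), (y : C))‖ < 1 := by
    have hres : Prod.map (IsLocalRing.residue _) (IsLocalRing.residue _)
        (henon^[2 * 3 ^ m] (x, y)) = Prod.map (IsLocalRing.residue _) (IsLocalRing.residue _)
        (x, y) :=
      (map_henon_iterate (IsLocalRing.residue (normInt C)) (x, y) _).trans
        (henon_iterate_eq_self ha hb)
    have hcoe : henon^[2 * 3 ^ m] ((x : C), (y : C)) =
        Prod.map ι ι (henon^[2 * 3 ^ m] (x, y)) := (map_henon_iterate ι (x, y) _).symm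
    rw [hcoe]
    exact max_lt (residue_eq_residue_iff.1 (congrArg Prod.fst hres))
      (residue_eq_residue_iff.1 (congrArg Prod.snd hres))
  obtain ⟨u, hu, hper⟩ := exists_isPeriodic_near
    (by exact_mod_cast norm_natCast_lt_one (C := C) 3) m
    (max_le (norm_coe_normInt_le_one x) (norm_coe_normInt_le_one y)) hnear
  obtain ⟨hint₁, hint₂⟩ := isIntegral_of_isPeriodic ℤ (by positivity) hper
  refine ⟨(⟨u.1, norm_le_one_of_isIntegral hint₁⟩, ⟨u.2, norm_le_one_of_isIntegral hint₂⟩),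
    (Prod.map_injective.2 ⟨Subtype.val_injective, Subtype.val_injective⟩) ?_, Prod.ext
      (residue_eq_residue_iff.2 ((norm_fst_le _).trans_lt hu))
      (residue_eq_residue_iff.2 ((norm_snd_le _).trans_lt hu))⟩
  exact (map_henon_iterate ι _ _).trans hper

lemma exists_toC3_eq {x : ℂ_[3]} (hx : IsIntegral ℤ x) : ∃ p : Qbar, toC3 p = x := by
  have hxQ : IsIntegral ℚ x := hx.tower_top
  have hmem : x ∈ toC3 '' (minpoly ℚ x).rootSet Qbar := by
    rw [Polynomial.Splits.image_rootSet (IsAlgClosed.splits _) toC3]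
    exact (Polynomial.mem_rootSet_of_ne (minpoly.ne_zero hxQ)).2 (minpoly.aeval ℚ x)
  exact hmem.imp fun p hp => hp.2

lemma exists_isPeriodic_toC3_eq {n : ℕ} (hn : 0 < n) {u : ℂ_[3] × ℂ_[3]} (hu : henon^[n] u = u) :
    ∃ v : Qbar × Qbar, henon^[n] v = v ∧ Prod.map toC3 toC3 v = u := by
  obtain ⟨hint₁, hint₂⟩ := isIntegral_of_isPeriodic ℤ hn hu
  obtain ⟨p, hp⟩ := exists_toC3_eq hint₁
  obtain ⟨q, hq⟩ := exists_toC3_eq hint₂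
  have hpq : Prod.map toC3 toC3 (p, q) = u := Prod.ext hp hq
  refine ⟨(p, q), Prod.map_injective.2 ⟨toC3.injective, toC3.injective⟩ ?_, hpq⟩
  exact (map_henon_iterate toC3.toRingHom (p, q) n).trans
    ((congrArg _ hpq).trans (hu.trans hpq.symm))

lemma norm_two_pow_sub_one_le (m : ℕ) : ‖(2 : ℂ_[3]) ^ (2 * 3 ^ m) - 1‖ ≤ (1 / 3) ^ (m + 1) := by
  obtain ⟨d, hd⟩ := dvd_sub_pow_of_dvd_sub (R := ℤ) (p := 3) (a := 4) (b := 1) (by norm_num) m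
  have h : (2 : ℂ_[3]) ^ (2 * 3 ^ m) - 1 = ((3 : ℕ) : ℂ_[3]) ^ (m + 1) * (d : ℂ_[3]) := by
    rw [pow_mul]
    norm_num
    simpa using congrArg (Int.cast : ℤ → ℂ_[3]) hd
  rw [h, norm_mul, norm_pow, norm_natCast_padicComplex, Padic.norm_p, one_div]
  exact mul_le_of_le_one_right (by positivity) (IsUltrametricDist.norm_intCast_le_one _ d)

lemma exists_mem_Per_residue_eq (m : ℕ) {v : Fin 2 → ResField ℂ_[3]}
    (hv : ∀ i, v i ^ 3 ^ 3 ^ m = v i) (htr : trThree m (v 0) ≠ trThree m (v 1)) :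
    ∃ P ∈ Per (2 * 3 ^ m) (onPoints f), 3 ^ (m + 1) ≤ ‖toC3 (P 2)‖ ∧
      ∃ u : Fin 2 → normInt ℂ_[3], (∀ i, IsLocalRing.residue _ (u i) = v i) ∧
        ∀ i, (u i : ℂ_[3]) = toC3 (P i.castSucc) := by
  set n := 2 * 3 ^ m
  have hn : 0 < n := by positivity
  obtain ⟨u, hu, huv⟩ := exists_isPeriodic_residue_eq m (hv 0) (hv 1)
  obtain ⟨w, hw, hwu⟩ := exists_isPeriodic_toC3_eq hn
    ((map_henon_iterate (normInt ℂ_[3]).subtype u n).symm.trans (congrArg _ hu))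
  have hs := mul_div_cancel₀ (orbitSum n w) (two_pow_sub_one_ne_zero hn.ne')
  refine ⟨![w.1, w.2, orbitSum n w / (2 ^ n - 1)], (mem_Per_iff _).2 ⟨hw, hs⟩, ?_, ![u.1, u.2],
    Fin.forall_fin_two.2 ⟨congrArg Prod.fst huv, congrArg Prod.snd huv⟩,
    Fin.forall_fin_two.2 ⟨congrArg Prod.fst hwu.symm, congrArg Prod.snd hwu.symm⟩⟩
  have hsum : ((orbitSum n u : normInt ℂ_[3]) : ℂ_[3]) = toC3 (orbitSum n w) :=
    (map_orbitSum (normInt ℂ_[3]).subtype n u).trans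
      ((congrArg _ hwu.symm).trans (map_orbitSum toC3.toRingHom n w).symm)
  have hunit : 1 ≤ ‖((orbitSum n u : normInt ℂ_[3]) : ℂ_[3])‖ := by
    rw [← not_lt, ← residue_eq_zero_iff, map_orbitSum, huv,
      orbitSum_two_mul_three_pow (hv 0) (hv 1), sub_eq_zero]
    exact htr
  rw [hsum, ← hs, map_mul, norm_mul, map_sub, map_pow, map_ofNat, map_one] at hunit
  have h := hunit.trans (mul_le_mul_of_nonneg_right (norm_two_pow_sub_one_le m) (norm_nonneg _))
  rwa [one_div, inv_pow, inv_mul_eq_div, one_le_div (by positivity)] at h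

end Residue

section Avoid

variable {C : Type*} [NormedField C] [IsUltrametricDist C]

lemma exists_smul_lift_residue_ne_zero {σ : Type*} {H : MvPolynomial σ C} (hH : H ≠ 0) :
    ∃ c : C, c ≠ 0 ∧ ∃ H₀ : MvPolynomial σ (normInt C),
      MvPolynomial.map (normInt C).subtype H₀ = c • H ∧
      MvPolynomial.map (IsLocalRing.residue (normInt C)) H₀ ≠ 0 := by
  obtain ⟨s, hs, hmax⟩ :=
    H.support.exists_max_image (fun t => ‖H.coeff t‖) (MvPolynomial.support_nonempty.2 hH)
  have hs0 : H.coeff s ≠ 0 := MvPolynomial.mem_support_iff.1 hs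
  have hint : (H.coeff s)⁻¹ • H ∈ Set.range (MvPolynomial.map (normInt C).subtype) := by
    refine MvPolynomial.mem_range_map_iff_coeffs_subset.2 fun a ha => ?_
    obtain ⟨t, ht, rfl⟩ := MvPolynomial.mem_coeffs_iff.1 ha
    have hle : ‖(H.coeff s)⁻¹ * H.coeff t‖ ≤ 1 := by
      rw [norm_mul, norm_inv, inv_mul_le_one₀ (norm_pos_iff.2 hs0)]
      exact hmax t (MvPolynomial.support_smul ht)
    exact ⟨⟨_, hle⟩, (MvPolynomial.coeff_smul t (H.coeff s)⁻¹ H).symm⟩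
  obtain ⟨H₀, hH₀⟩ := hint
  refine ⟨_, inv_ne_zero hs0, H₀, hH₀, MvPolynomial.ne_zero_iff.2 ⟨s, ?_⟩⟩
  have hone : H₀.coeff s = 1 := Subtype.val_injective <| by
    have h := congrArg (MvPolynomial.coeff s) hH₀
    rwa [MvPolynomial.coeff_map, MvPolynomial.coeff_smul, smul_eq_mul, inv_mul_cancel₀ hs0] at h
  rw [MvPolynomial.coeff_map, hone, map_one]
  exact one_ne_zero

lemma exists_nnnorm_eval_eq {σ : Type*} {H : MvPolynomial σ C} (hH : H ≠ 0) :
    ∃ G : MvPolynomial σ (ResField C), G ≠ 0 ∧ ∃ δ : NNReal, 0 < δ ∧ ∀ u : σ → normInt C,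
      ‖MvPolynomial.eval (fun i => (u i : C)) H‖₊ ≤ δ ∧
      (MvPolynomial.eval (fun i => IsLocalRing.residue _ (u i)) G ≠ 0 →
        ‖MvPolynomial.eval (fun i => (u i : C)) H‖₊ = δ) := by
  obtain ⟨c, hc, H₀, hmap, hred⟩ := exists_smul_lift_residue_ne_zero hH
  have hc' : 0 < ‖c‖₊ := nnnorm_pos.2 hc
  refine ⟨_, hred, ‖c‖₊⁻¹, by positivity, fun u => ?_⟩
  have hnorm : ‖MvPolynomial.eval (fun i => (u i : C)) H‖₊ =
      ‖c‖₊⁻¹ * ‖((MvPolynomial.eval u H₀ : normInt C) : C)‖₊ := by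
    have h : ((MvPolynomial.eval u H₀ : normInt C) : C) =
        c * MvPolynomial.eval (fun i => (u i : C)) H := by
      rw [← MvPolynomial.smul_eval, ← hmap]
      exact MvPolynomial.map_eval (normInt C).subtype u H₀
    rw [h, nnnorm_mul, inv_mul_cancel_left₀ hc'.ne']
  have hle := norm_coe_normInt_le_one (MvPolynomial.eval u H₀)
  rw [hnorm]
  refine ⟨mul_le_of_le_one_right (by positivity) hle, fun hu => ?_⟩
  have hunit : ¬ ‖((MvPolynomial.eval u H₀ : normInt C) : C)‖ < 1 := by
    rwa [← residue_eq_zero_iff, MvPolynomial.map_eval]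
  rw [show ‖((MvPolynomial.eval u H₀ : normInt C) : C)‖₊ = 1 from
    NNReal.eq (hle.antisymm (not_lt.1 hunit)), mul_one]

lemma exists_nnnorm_eval_le {σ : Type*} (H : MvPolynomial σ C) :
    ∃ B : NNReal, ∀ u : σ → normInt C, ‖MvPolynomial.eval (fun i => (u i : C)) H‖₊ ≤ B := by
  rcases eq_or_ne H 0 with rfl | hH
  · exact ⟨0, fun u => by simp⟩
  · obtain ⟨_, _, B, _, hB⟩ := exists_nnnorm_eval_eq hH
    exact ⟨B, fun u => (hB u).1⟩

-- For fixed integral `u` the roots of `F (·, u)` obey the Cauchy bound, which is uniform in `u`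
-- as long as `u` avoids the reduction of the leading coefficient.
lemma exists_residue_eval_cons_ne_zero {n : ℕ} {F : MvPolynomial (Fin (n + 1)) C} (hF : F ≠ 0) :
    ∃ G : MvPolynomial (Fin n) (ResField C), G ≠ 0 ∧ ∃ B : ℝ, ∀ (u : Fin n → normInt C) (z : C),
      MvPolynomial.eval (fun i => IsLocalRing.residue _ (u i)) G ≠ 0 → B ≤ ‖z‖ →
        MvPolynomial.eval (Fin.cons z (fun i => (u i : C)) : Fin (n + 1) → C) F ≠ 0 := by
  set p := MvPolynomial.finSuccEquiv C n F with hp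
  have hp0 : p ≠ 0 := (map_ne_zero_iff _ (AlgEquiv.injective _)).2 hF
  obtain ⟨G, hG, δ, hδ, hlead⟩ := exists_nnnorm_eval_eq (Polynomial.leadingCoeff_ne_zero.2 hp0)
  choose b hb using fun i => exists_nnnorm_eval_le (p.coeff i)
  refine ⟨G, hG, ↑((Finset.range p.natDegree).sup b / δ + 1 : NNReal), fun u z hu hz h => ?_⟩
  set q := p.map (MvPolynomial.eval fun i => (u i : C)) with hq
  have hlc : ‖MvPolynomial.eval (fun i => (u i : C)) p.leadingCoeff‖₊ = δ := (hlead u).2 hu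
  have hne : MvPolynomial.eval (fun i => (u i : C)) p.leadingCoeff ≠ 0 :=
    nnnorm_ne_zero_iff.1 (hlc ▸ hδ.ne')
  have hdeg : q.natDegree = p.natDegree := Polynomial.natDegree_map_of_leadingCoeff_ne_zero _ hne
  have hcauchy : q.cauchyBound ≤ (Finset.range p.natDegree).sup b / δ + 1 := by
    rw [Polynomial.cauchyBound, hdeg, Polynomial.leadingCoeff_map_of_leadingCoeff_ne_zero _ hne,
      hlc]
    gcongr with i
    rw [Polynomial.coeff_map]
    exact hb i u
  have hroot : q.IsRoot z := by
    rwa [Polynomial.IsRoot, hq, hp, ← MvPolynomial.eval_eq_eval_mv_eval']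
  have hq0 : q ≠ 0 := fun h0 => hne (by
    rw [← Polynomial.leadingCoeff_map_of_leadingCoeff_ne_zero _ hne, ← hq, h0,
      Polynomial.leadingCoeff_zero])
  exact ((hroot.norm_lt_cauchyBound hq0).trans_le hcauchy).not_ge hz

lemma exists_residue_eval_ne_zero {n : ℕ} {F : MvPolynomial (Fin (n + 1)) C} (hF : F ≠ 0) :
    ∃ G : MvPolynomial (Fin n) (ResField C), G ≠ 0 ∧ ∃ B : ℝ,
      ∀ (u : Fin n → normInt C) (x : Fin (n + 1) → C), (∀ i, (u i : C) = x i.castSucc) →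
        MvPolynomial.eval (fun i => IsLocalRing.residue _ (u i)) G ≠ 0 → B ≤ ‖x (Fin.last n)‖ →
          MvPolynomial.eval x F ≠ 0 := by
  have hF' : MvPolynomial.rename (finRotate _) F ≠ 0 :=
    (map_ne_zero_iff _ (MvPolynomial.rename_injective _ (finRotate _).injective)).2 hF
  obtain ⟨G, hG, B, h⟩ := exists_residue_eval_cons_ne_zero hF'
  refine ⟨G, hG, B, fun u x hx hu hB => ?_⟩
  have hrot : (Fin.cons (x (Fin.last n)) (fun i => (u i : C)) : Fin (n + 1) → C) ∘ finRotate _ =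
      x := by
    rw [funext hx]
    exact (Fin.snoc_eq_cons_rotate _ _).symm.trans (Fin.snoc_init_self x)
  have := h u _ hu hB
  rwa [MvPolynomial.eval_rename, hrot] at this

end Avoid

section Count

lemma card_zeros_le {R : Type*} [CommRing R] [IsDomain R] [DecidableEq R] {n : ℕ}
    {p : MvPolynomial (Fin (n + 1)) R} (hp : p ≠ 0) (S : Finset R) :
    (Finset.filter (fun v => MvPolynomial.eval v p = 0) (Fintype.piFinset fun _ => S)).card ≤
      p.totalDegree * S.card ^ n := by
  rcases S.eq_empty_or_nonempty with rfl | hS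
  · simp
  have hS : (0 : ℚ≥0) < S.card := by exact_mod_cast hS.card_pos
  have h := MvPolynomial.schwartz_zippel_totalDegree hp S
  rw [div_le_div_iff₀ (by positivity) hS, pow_succ, ← mul_assoc] at h
  exact_mod_cast le_of_mul_le_mul_right h hS

variable {k : Type*} [Field k]

lemma exists_finset_pow_eq_self [IsAlgClosed k] (p : ℕ) [hp : Fact p.Prime] [CharP k p] {r : ℕ}
    (hr : r ≠ 0) : ∃ S : Finset k, S.card = p ^ r ∧ ∀ a ∈ S, a ^ p ^ r = a := by
  classical
  set g := (Polynomial.X ^ p ^ r - Polynomial.X : Polynomial k)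
  have hcard : Fintype.card (g.rootSet k) = p ^ r := by
    rw [Polynomial.card_rootSet_eq_natDegree (galois_poly_separable p _ (dvd_pow_self p hr))
      (IsAlgClosed.splits _), FiniteField.X_pow_card_pow_sub_X_natDegree_eq k hr hp.out.one_lt]
  refine ⟨(g.rootSet k).toFinset, by rw [Set.toFinset_card, hcard], fun a ha => ?_⟩
  simpa [g, sub_eq_zero] using (Polynomial.mem_rootSet.1 (Set.mem_toFinset.1 ha)).2

/-- The difference of the traces of the two coordinates of the plane. -/
noncomputable def trDiffPoly (k : Type*) [Field k] (m : ℕ) : MvPolynomial (Fin 2) k :=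
  trThree m (MvPolynomial.X 0) - trThree m (MvPolynomial.X 1)

lemma eval_trDiffPoly (m : ℕ) (v : Fin 2 → k) :
    MvPolynomial.eval v (trDiffPoly k m) = trThree m (v 0) - trThree m (v 1) := by
  simp only [trDiffPoly, map_sub, map_trThree, MvPolynomial.eval_X]

lemma trDiffPoly_ne_zero (m : ℕ) : trDiffPoly k m ≠ 0 := fun h => by
  have hX := congrArg (Polynomial.coeff · 1)
    (congrArg (MvPolynomial.aeval ![(Polynomial.X : Polynomial k), 0]) h)
  simp [trDiffPoly, trThree, Polynomial.coeff_X_pow, eq_comm (a := 1)] at hX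

lemma totalDegree_trDiffPoly_le (m : ℕ) : (trDiffPoly k m).totalDegree ≤ 3 ^ (3 ^ m - 1) := by
  have h (j : Fin 2) :
      (trThree m (MvPolynomial.X j : MvPolynomial (Fin 2) k)).totalDegree ≤ 3 ^ (3 ^ m - 1) := by
    refine MvPolynomial.totalDegree_finsetSum_le fun i hi => ?_
    rw [MvPolynomial.totalDegree_X_pow]
    exact Nat.pow_le_pow_right (by norm_num) (Nat.le_pred_of_lt (Finset.mem_range.1 hi))
  exact (MvPolynomial.totalDegree_sub _ _).trans (max_le (h 0) (h 1))

lemma exists_finset_trThree_ne [IsAlgClosed k] [CharP k 3] {G : MvPolynomial (Fin 2) k}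
    (hG : G ≠ 0) {m : ℕ} (hm : 3 * G.totalDegree ≤ 3 ^ 3 ^ m) :
    ∃ V : Finset (Fin 2 → k), 3 ^ (2 * 3 ^ m) ≤ 3 * V.card ∧ ∀ v ∈ V,
      (∀ i, v i ^ 3 ^ 3 ^ m = v i) ∧ MvPolynomial.eval v G ≠ 0 ∧
        trThree m (v 0) ≠ trThree m (v 1) := by
  classical
  obtain ⟨S, hcard, hS⟩ := exists_finset_pow_eq_self (k := k) 3 (r := 3 ^ m) (by positivity)
  set H := G * trDiffPoly k m
  set q := 3 ^ 3 ^ m with hqdef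
  refine ⟨(Fintype.piFinset fun _ => S).filter fun v => ¬ MvPolynomial.eval v H = 0, ?_,
    fun v hv => ?_⟩
  · have hq : q = 3 * 3 ^ (3 ^ m - 1) := (mul_pow_sub_one (by positivity) 3).symm
    have hdeg : 3 * H.totalDegree ≤ 2 * q := by
      have : H.totalDegree ≤ _ := MvPolynomial.totalDegree_mul G (trDiffPoly k m)
      have := totalDegree_trDiffPoly_le (k := k) m
      omega
    have hzeros := card_zeros_le (mul_ne_zero hG (trDiffPoly_ne_zero m)) S
    have htotal := Finset.card_filter_add_card_filter_not (s := Fintype.piFinset fun _ => S)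
      (fun v => MvPolynomial.eval v H = 0)
    rw [Fintype.card_piFinset_const, hcard] at htotal
    rw [hcard, pow_one] at hzeros
    have hpow : 3 ^ (2 * 3 ^ m) = q ^ 2 := by rw [hqdef, ← pow_mul, mul_comm]
    rw [hpow]
    nlinarith
  · obtain ⟨hvS, hvH⟩ := Finset.mem_filter.1 hv
    rw [map_mul, mul_eq_zero, not_or, eval_trDiffPoly, sub_eq_zero] at hvH
    exact ⟨fun i => hS _ (Fintype.mem_piFinset.1 hvS i), hvH⟩

end Count

lemma exists_finset_subset_Per {F : MvPolynomial (Fin 3) Qbar} (hF : F ≠ 0) :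
    ∀ᶠ m : ℕ in atTop, ∃ U : Finset (Fin 3 → Qbar),
      (U : Set (Fin 3 → Qbar)) ⊆ Per (2 * 3 ^ m) (onPoints f) ∧ 3 ^ (2 * 3 ^ m) ≤ 3 * U.card ∧
      ∀ P ∈ U, MvPolynomial.eval P F ≠ 0 ∧ 3 ^ m ≤ ‖toC3 (P 2)‖ := by
  classical
  have hF' : MvPolynomial.map toC3.toRingHom F ≠ 0 :=
    (map_ne_zero_iff _ (MvPolynomial.map_injective _ toC3.toRingHom.injective)).2 hF
  obtain ⟨G, hG, B, hGF⟩ := exists_residue_eval_ne_zero hF'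
  have hlarge : ∀ᶠ m : ℕ in atTop, B ≤ (3 : ℝ) ^ m :=
    (tendsto_pow_atTop_atTop_of_one_lt (by norm_num)).eventually_ge_atTop B
  filter_upwards [hlarge, eventually_ge_atTop (3 * G.totalDegree)] with m hBm hGm
  obtain ⟨V, hcard, hV⟩ := exists_finset_trThree_ne hG (hGm.trans ((Nat.lt_pow_self
    (by norm_num)).le.trans (Nat.lt_pow_self (by norm_num : 1 < 3)).le))
  choose! P hP hz u hres hu using fun v hv =>
    exists_mem_Per_residue_eq m (hV v hv).1 (hV v hv).2.2
  have hinj : Set.InjOn P V := fun v hv v' hv' h => funext fun i => by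
    have hcoord : u v i = u v' i := Subtype.val_injective (by rw [hu v hv, hu v' hv', h])
    rw [← hres v hv, ← hres v' hv', hcoord]
  refine ⟨V.image P, ?_, by rwa [Finset.card_image_of_injOn hinj], ?_⟩
  · rw [Finset.coe_image]
    exact Set.image_subset_iff.2 hP
  · refine Finset.forall_mem_image.2 fun v hv => ?_
    have hzm : (3 : ℝ) ^ m ≤ ‖toC3 (P v 2)‖ :=
      (pow_le_pow_right₀ (by norm_num) m.le_succ).trans (hz v hv)
    refine ⟨fun h => hGF (u v) (toC3 ∘ P v) (hu v hv) ?_ (hBm.trans hzm) ?_, hzm⟩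
    · rw [funext (hres v hv)]
      exact (hV v hv).2.1
    · exact (MvPolynomial.map_eval toC3.toRingHom (P v) F).symm.trans
        ((congrArg toC3.toRingHom h).trans (map_zero _))

section GaloisOrbits

/-- The absolute Galois group of `ℚ`, acting on points coordinatewise. -/
abbrev GaloisGroup : Type := Qbar ≃ₐ[ℚ] Qbar

variable {N : ℕ}

lemma conjugates_injective (P : Fin N → Qbar) : Function.Injective
    fun (σ : fieldOfDef P →ₐ[ℚ] Qbar) i => σ (coords P i) := fun σ τ h =>
  IntermediateField.algHom_ext_of_eq_adjoin _ rfl <| by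
    rintro _ ⟨i, rfl⟩
    exact congrFun h i

lemma range_conjugates (P : Fin N → Qbar) :
    Set.range (fun (σ : fieldOfDef P →ₐ[ℚ] Qbar) i => σ (coords P i)) =
      MulAction.orbit GaloisGroup P := by
  refine Set.Subset.antisymm ?_ ?_
  · rintro _ ⟨σ, rfl⟩
    obtain ⟨φ, rfl⟩ := IsAlgClosed.surjective_domRestrict_of_isAlgebraic (E := Qbar) σ
    exact ⟨AlgEquiv.ofBijective φ (Algebra.IsAlgebraic.algHom_bijective φ), rfl⟩
  · rintro _ ⟨γ, rfl⟩
    exact ⟨γ.toAlgHom.comp (fieldOfDef P).val, rfl⟩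

lemma ncard_orbit (P : Fin N → Qbar) :
    (MulAction.orbit GaloisGroup P).ncard = Module.finrank ℚ (fieldOfDef P) := by
  rw [← range_conjugates, ← Set.image_univ, Set.ncard_image_of_injective _ (conjugates_injective P),
    Set.ncard_univ, Nat.card_eq_fintype_card, AlgHom.card]

lemma le_height_of_subset_orbit {P : Fin N → Qbar} {V : Finset (Fin N → Qbar)}
    (hV : (V : Set (Fin N → Qbar)) ⊆ MulAction.orbit GaloisGroup P) (i : Fin N) (m : ℕ)
    (hm : ∀ Q ∈ V, 3 ^ m ≤ ‖toC3 (Q i)‖) :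
    V.card * (m * Real.log 3) ≤ (MulAction.orbit GaloisGroup P).ncard * height P := by
  classical
  set I : Finset (fieldOfDef P →ₐ[ℚ] Qbar) := {σ | (fun j => σ (coords P j)) ∈ V}
  have hcard : V.card = I.card := by
    rw [← Finset.card_image_of_injective I (conjugates_injective P)]
    refine congrArg Finset.card (Finset.ext fun Q => ⟨fun hQ => ?_, fun hQ => ?_⟩)
    · rw [← range_conjugates] at hV
      obtain ⟨σ, rfl⟩ := hV hQ
      exact Finset.mem_image_of_mem _ (Finset.mem_filter.2 ⟨Finset.mem_univ _, hQ⟩)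
    · obtain ⟨σ, hσ, rfl⟩ := Finset.mem_image.1 hQ
      exact (Finset.mem_filter.1 hσ).2
  have hfin : (0 : ℝ) < Module.finrank ℚ (fieldOfDef P) := by
    exact_mod_cast Module.finrank_pos
  have h := le_height_of_conjugates P i m I fun σ hσ => hm _ (Finset.mem_filter.1 hσ).2
  rwa [div_mul_eq_mul_div, div_le_iff₀' hfin, ← hcard, ← ncard_orbit] at h

lemma exists_card_fiber_le {α β : Type*} [DecidableEq β] (q : α → β) {S U : Finset α} {c : ℕ}
    (hU : U.Nonempty) (hcard : S.card ≤ c * U.card) :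
    ∃ a ∈ U, (S.filter (q · = q a)).card ≤ c * (U.filter (q · = q a)).card := by
  by_contra! h
  have hlt : ∑ b ∈ U.image q, c * (U.filter (q · = b)).card <
      ∑ b ∈ U.image q, (S.filter (q · = b)).card :=
    Finset.sum_lt_sum_of_nonempty (hU.image q) (Finset.forall_mem_image.2 h)
  rw [← Finset.mul_sum, Finset.sum_card_fiberwise_eq_card_filter,
    Finset.sum_card_fiberwise_eq_card_filter,
    Finset.filter_true_of_mem fun a => Finset.mem_image_of_mem q] at hlt
  exact (hlt.trans_le (Finset.card_filter_le _ _)).not_ge hcard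

-- Some Galois orbit meets `U` in at least a `c`-th of its points.
lemma exists_le_height {S U : Finset (Fin N → Qbar)} {c : ℕ}
    (hS : ∀ P ∈ S, ∀ γ : GaloisGroup, γ • P ∈ S) (hUS : U ⊆ S) (hU : U.Nonempty)
    (hcard : S.card ≤ c * U.card) (i : Fin N) (m : ℕ) (hm : ∀ P ∈ U, 3 ^ m ≤ ‖toC3 (P i)‖) :
    ∃ P ∈ U, m * Real.log 3 ≤ c * height P := by
  classical
  obtain ⟨P, hPU, hP⟩ := exists_card_fiber_le (MulAction.orbit GaloisGroup) hU hcard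
  refine ⟨P, hPU, ?_⟩
  set V := U.filter (MulAction.orbit GaloisGroup · = MulAction.orbit GaloisGroup P)
  have horbit : (MulAction.orbit GaloisGroup P).ncard ≤ c * V.card := by
    refine le_trans ?_ hP
    rw [← Set.ncard_coe_finset]
    refine Set.ncard_le_ncard ?_ (Finset.finite_toSet _)
    rintro _ ⟨γ, rfl⟩
    exact Finset.mem_filter.2 ⟨hS P (hUS hPU) γ, MulAction.orbit_smul γ P⟩
  have hV0 : (0 : ℝ) < V.card := by
    exact_mod_cast Finset.card_pos.2 (⟨P, Finset.mem_filter.2 ⟨hPU, rfl⟩⟩ : V.Nonempty)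
  have hle := le_height_of_subset_orbit (P := P) (V := V)
    (fun Q hQ => MulAction.orbit_eq_iff.1 (Finset.mem_filter.1 hQ).2) i m
    fun Q hQ => hm Q (Finset.mem_filter.1 hQ).1
  have hheight : 0 ≤ height P := by
    unfold height
    positivity
  refine le_of_mul_le_mul_left (hle.trans ?_) hV0
  calc (MulAction.orbit GaloisGroup P).ncard * height P
      ≤ (c * V.card : ℕ) * height P := by gcongr
    _ = V.card * (c * height P) := by push_cast; ring

lemma smul_mem_Per {F : Fin N → MvPolynomial (Fin N) ℚ} {P : Fin N → Qbar} {n : ℕ}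
    (hP : P ∈ Per n (onPoints F)) (γ : GaloisGroup) : γ • P ∈ Per n (onPoints F) := by
  have hcomm : Function.Commute (onPoints F) (γ • ·) := fun Q =>
    funext fun i => (MvPolynomial.comp_aeval_apply Q γ.toAlgHom (F i)).symm
  exact (hcomm.iterate_left n P).trans (congrArg (γ • ·) hP)

end GaloisOrbits

section Conclusion

lemma exists_periodic_lt_height {F : MvPolynomial (Fin 3) Qbar} (hF : F ≠ 0) (B : ℝ) :
    ∃ P ∈ PerAll (onPoints f), MvPolynomial.eval P F ≠ 0 ∧ B < height P := by
  have hlarge : ∀ᶠ m : ℕ in atTop, 3 * B < m * Real.log 3 :=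
    (tendsto_natCast_atTop_atTop.atTop_mul_const
      (Real.log_pos (by norm_num))).eventually_gt_atTop _
  obtain ⟨m, ⟨U, hU, hUcard, hUP⟩, hm⟩ := ((exists_finset_subset_Per hF).and hlarge).exists
  have hn : 1 ≤ 2 * 3 ^ m := Nat.succ_le_of_lt (by positivity)
  have hUne : U.Nonempty := Finset.card_pos.1
    (Nat.pos_of_mul_pos_left ((Nat.pow_pos three_pos).trans_le hUcard))
  have hScard : (finite_Per hn).toFinset.card ≤ 3 * U.card := by
    rw [← Set.ncard_eq_toFinset_card _ (finite_Per hn)]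
    exact (ncard_Per_le hn).trans hUcard
  obtain ⟨P, hPU, hP⟩ := exists_le_height (S := (finite_Per hn).toFinset)
    (fun Q hQ γ => (finite_Per hn).mem_toFinset.2
      (smul_mem_Per ((finite_Per hn).mem_toFinset.1 hQ) γ))
    (fun Q hQ => (finite_Per hn).mem_toFinset.2 (hU hQ)) hUne hScard 2 m fun Q hQ => (hUP Q hQ).2
  refine ⟨P, ⟨_, hn, hU hPU⟩, (hUP P hPU).1, ?_⟩
  push_cast at hP
  linarith

variable {N : ℕ}

lemma mem_zariskiClosure_iff {S : Set (Fin N → Qbar)} {P : Fin N → Qbar} :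
    P ∈ zariskiClosure S ↔ ∀ F : MvPolynomial (Fin N) Qbar,
      (∀ Q ∈ S, MvPolynomial.eval Q F = 0) → MvPolynomial.eval P F = 0 := by
  simp only [zariskiClosure, MvPolynomial.mem_zeroLocus_iff, MvPolynomial.mem_vanishingIdeal_iff,
    MvPolynomial.aeval_eq_eval]

lemma zariskiClosure_eq_self_of_finite {S : Set (Fin N → Qbar)} (hS : S.Finite) :
    zariskiClosure S = S := by
  refine Set.Subset.antisymm (fun P hP => by_contra fun hPS => ?_)
    fun P hP => mem_zariskiClosure_iff.2 fun F hF => hF P hP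
  have hsep : ∀ Q ∈ S, ∃ L : MvPolynomial (Fin N) Qbar,
      MvPolynomial.eval Q L = 0 ∧ MvPolynomial.eval P L ≠ 0 := fun Q hQ => by
    obtain ⟨i, hi⟩ := Function.ne_iff.1 (ne_of_mem_of_not_mem hQ hPS)
    exact ⟨MvPolynomial.X i - MvPolynomial.C (Q i), by simp, by simpa [sub_eq_zero] using hi.symm⟩
  choose! L hLQ hLP using hsep
  have hprod := mem_zariskiClosure_iff.1 hP (∏ Q ∈ hS.toFinset, L Q) fun Q hQ => by
    rw [map_prod]
    exact Finset.prod_eq_zero (hS.mem_toFinset.2 hQ) (hLQ Q hQ)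
  rw [map_prod, Finset.prod_eq_zero_iff] at hprod
  obtain ⟨Q, hQ, hQ0⟩ := hprod
  exact hLP Q (hS.mem_toFinset.1 hQ) hQ0

lemma isolatedPer_eq_perAll {φ : (Fin N → Qbar) → (Fin N → Qbar)}
    (hφ : ∀ n, 1 ≤ n → (Per n φ).Finite) : IsolatedPer φ = PerAll φ := by
  refine Set.Subset.antisymm (fun P hP => hP.1) fun P hP => ⟨hP, fun n hn => ?_⟩
  rw [zariskiClosure_eq_self_of_finite ((hφ n hn).subset Set.sdiff_subset)]
  exact fun h => h.2 rfl

lemma isolatedPer_f : IsolatedPer (onPoints f) = PerAll (onPoints f) :=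
  isolatedPer_eq_perAll fun _ => finite_Per

instance countable_Qbar : Countable Qbar := by
  rw [← Cardinal.mk_le_aleph0_iff]
  exact (Algebra.IsAlgebraic.cardinalMk_le_max ℚ Qbar).trans (by simp)

instance countable_mvPolynomial {σ R : Type*} [Countable σ] [CommRing R] [Countable R] :
    Countable (MvPolynomial σ R) := by
  rw [← Cardinal.mk_le_aleph0_iff]
  refine MvPolynomial.cardinalMk_le_max_lift.trans ?_
  simp

lemma exists_dense_sequence : ∃ P : ℕ → (Fin 3 → Qbar), (∀ i, P i ∈ PerAll (onPoints f)) ∧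
    Tendsto (fun i => height (P i)) atTop atTop ∧ zariskiClosure (Set.range P) = Set.univ := by
  have : Nonempty {F : MvPolynomial (Fin 3) Qbar // F ≠ 0} := ⟨⟨1, one_ne_zero⟩⟩
  obtain ⟨F, hF⟩ := exists_surjective_nat {F : MvPolynomial (Fin 3) Qbar // F ≠ 0}
  choose P hP hPF hPh using fun i : ℕ => exists_periodic_lt_height (F i).2 i
  refine ⟨P, hP, tendsto_atTop_mono (fun i => (hPh i).le) tendsto_natCast_atTop_atTop, ?_⟩
  refine Set.eq_univ_of_forall fun Q => mem_zariskiClosure_iff.2 fun G hG => ?_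
  have hG0 : G = 0 := by
    by_contra hne
    obtain ⟨i, hi⟩ := hF ⟨G, hne⟩
    exact hPF i (hi ▸ hG (P i) ⟨i, rfl⟩)
  rw [hG0, map_zero]

lemma not_heightBounded : ¬ HeightBounded (IsolatedPer (onPoints f)) := by
  rintro ⟨B, hB⟩
  obtain ⟨P, hP, -, hBP⟩ := exists_periodic_lt_height one_ne_zero B
  exact (hBP.trans_le ((le_abs_self _).trans (hB P (isolatedPer_f ▸ hP)))).false

lemma not_silvermanConjecture : ¬ SilvermanConjecture := fun h => by
  have hbounded := h 3 _ (isAutomorphism_f.map (K := Qbar)) (by rw [degree_map, degree_f]; norm_num)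
  exact not_heightBounded (by rwa [onPoints_map] at hbounded)

end Conclusion

end AffineDyn

open AffineDyn in
theorem theorem2p1 :
    -- `f` is an automorphism and both dynamical degrees are `3`
    (IsAutomorphism f ∧ HasDynamicalDegree (onPoints f) 1 3 ∧
      HasDynamicalDegree (onPoints f) 2 3) ∧
    -- finitely many `n`-periodic points, and all periodic points are isolated
    ((∀ n : ℕ, 1 ≤ n → (Per n (onPoints f)).Finite) ∧
      ∀ P ∈ PerAll (onPoints f), P ∈ IsolatedPer (onPoints f)) ∧
    -- a Zariski dense sequence of periodic points whose height tends to infinity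
    (∃ P : ℕ → (Fin 3 → Qbar), (∀ i, P i ∈ PerAll (onPoints f)) ∧
      Tendsto (fun i => height (P i)) atTop atTop ∧
      zariskiClosure (Set.range P) = Set.univ) ∧
    -- hence `f` is a counterexample to Silverman's conjecture
    (2 ≤ degree f ∧ ¬ HeightBounded (IsolatedPer (onPoints f)) ∧ ¬ SilvermanConjecture) := by
  refine ⟨⟨isAutomorphism_f, ?_, ?_⟩, ⟨fun _ => finite_Per, fun P hP => isolatedPer_f ▸ hP⟩,
    exists_dense_sequence, by rw [degree_f]; norm_num, not_heightBounded, not_silvermanConjecture⟩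
  · exact_mod_cast hasDynamicalDegree_of_pow hasDegree_one_onPoints_f_iterate
  · exact_mod_cast hasDynamicalDegree_of_pow hasDegree_two_onPoints_f_iterate
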